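/- Let $H_{\mathbb R}$ be a real Hilbert space, $H$ its complexification (inner product antilinear in the first variable), and $x\mapsto\bar x$ a bounded self-adjoint linear involution of $H$. Let $(T_x)_{x\in H_{\mathbb R}}$ be bounded self-adjoint operators on $H$ and $\alpha,q\in(-1,1)$. On the algebraic full Fock space $\bigoplus_{n\ge0}H^{\otimes n}$ with vacuum $\Omega$ consider the $(\alpha,q)$-inner product $\langle f,g\rangle_{\alpha,q}=\langle f,P^{(n)}_{\alpha,q}g\rangle_{0,0}$ for $f,g\in H^{\otimes n}$ (different degrees are orthogonal), where $\langle\cdot,\cdot\rangle_{0,0}$ is the usual inner product, $P^{(n)}_{\alpha,q}=\sum_{\sigma\in\Sigma(n)}\alpha^{l_1(\sigma)}q^{l_2(\sigma)}\sigma$, $\Sigma(n)$ is the hyperoctahedral group acting on $H^{\otimes n}$ by permuting the factors and, for $\pi_0$, by applying the involution to the first factor, and $l_1(\sigma)$ (resp. $l_2(\sigma)$) is the number of generators $\pi_0$ (resp. $\pi_1,\dots,\pi_{n-1}$) in a reduced word of $\sigma$. Put $\varphi_{\alpha,q}(X)=\langle\Omega,X\Omega\rangle_{\alpha,q}$ and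 $\mathcal B_{\alpha,q}(x)=b_{\alpha,q}(x)+b^*_{\alpha,q}(x)+p(T_x)$ for $x\in H_{\mathbb R}$, where $b_{\alpha,q}(x)\Omega=p(T)\Omega=0$ and $$b_{\alpha,q}(x)(x_1\otimes\cdots\otimes x_n)=\sum_{k=1}^n\big(q^{n-k}\langle x,x_k\rangle+\alpha q^{n+k-2}\langle x,\bar x_k\rangle\big)\,x_1\otimes\cdots\check x_k\cdots\otimes x_n,$$ $$p(T)(x_1\otimes\cdots\otimes x_n)=\sum_{k=1}^n x_1\otimes\cdots\check x_k\cdots\otimes x_n\otimes T\big(q^{n-k}x_k+\alpha q^{n+k-2}\bar x_k\big),$$ and $b^*_{\alpha,q}(x)$, the adjoint of $b_{\alpha,q}(x)$ for the $(\alpha,q)$-inner product, is $x_1\otimes\cdots\otimes x_n\mapsto x_1\otimes\cdots\otimes x_n\otimes x$. For a set partition $\pi$ of $[n]=\{1,\dots,n\}$ an arc is a pair $(i,j)$ of consecutive elements $i<j$ of a block. The arc $(i,j)$ nests $(i',j')$ if $i<i'$ and $j'<j$; $\mathrm{rc}(\pi)$ is the number of pairs of arcs with $i<i'<j<j'$.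 $\mathcal P_{\ge2}(n)$ is the set of partitions of $[n]$ without singletons, $\mathcal{NC}_{\ge2}(n)$ its subset of noncrossing partitions, $\#\mathrm{OutArc}(\pi)$ the number of arcs nested by no other arc. $\mathcal P^B_2(n)$ is the set of pairs $\pi_f=(\pi,f)$ of a pair partition $\pi$ of $[n]$ and a colouring $f$ of its arcs by $\pm1$; $\mathrm{Narc}(\pi_f)$ is the number of arcs of colour $-1$ and $\mathrm{rnarc}(\pi_f)$ the number of pairs $(V,W)$ of arcs such that $V$ nests $W$ and $f(W)=-1$. For a block $B=\{i_1<\dots<i_m\}$, $m\ge2$, put $K(B)=\langle x_{i_m},T_{x_{i_{m-1}}}\cdots T_{x_{i_2}}x_{i_1}\rangle$. Let $n\ge0$ and $x_1,\dots,x_n\in H_{\mathbb R}$. Then: 1. (case $\alpha=0$) $\displaystyle\varphi_{0,q}\big(\mathcal B_{0,q}(x_n)\cdots\mathcal B_{0,q}(x_1)\big)=\sum_{\pi\in\mathcal P_{\ge2}(n)}q^{\mathrm{rc}(\pi)}\prod_{B\in\pi}K(B).$ 2. If $T_x=0$ for all $x$, then $$\varphi_{\alpha,q}\big(\mathcal B_{\alpha,q}(x_n)\cdots\mathcal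 B_{\alpha,q}(x_1)\big)=\sum_{\pi_f\in\mathcal P^B_2(n)}\alpha^{\mathrm{Narc}(\pi_f)}q^{\mathrm{rc}(\pi)+2\,\mathrm{rnarc}(\pi_f)}\prod_{\substack{(i,j)\ \text{arc}\\ f(i,j)=1}}\langle x_j,x_i\rangle\prod_{\substack{(i,j)\ \text{arc}\\ f(i,j)=-1}}\langle x_j,\overline{x_i}\rangle .$$ 3. (case $q=0$) If $\overline{x_i}=x_i$ and the involution commutes with $T_{x_i}$ for every $i$ (for instance, if the involution is the identity), then $$\varphi_{\alpha,0}\big(\mathcal B_{\alpha,0}(x_n)\cdots\mathcal B_{\alpha,0}(x_1)\big)=\sum_{\pi\in\mathcal{NC}_{\ge2}(n)}(1+\alpha)^{\#\mathrm{OutArc}(\pi)}\prod_{B\in\pi}K(B).$$ -/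

import Mathlib

open scoped TensorProduct DirectSum InnerProductSpace

noncomputable section

namespace TypeB

/-! ### Complexification and the algebraic full Fock space -/

/-- `ι : HR → H` exhibits the complex inner product space `H` as the complexification of the real
inner product space `HR`: it is real linear, it preserves inner products, and every vector of `H`
has the form `ι u + i ι v`. (The inner product of `H` is antilinear in the first variable.) -/
structure IsComplexification {HR H : Type*} [NormedAddCommGroup HR] [InnerProductSpace ℝ HR]
    [NormedAddCommGroup H] [InnerProductSpace ℂ H] (ι : HR →ₗ[ℝ] H) : Prop where
  inner_map : ∀ u v : HR, ⟪ι u, ι v⟫_ℂ = ((⟪u, v⟫_ℝ : ℝ) : ℂ)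
  exists_eq : ∀ z : H, ∃ u v : HR, z = ι u + Complex.I • ι v

section Fock

variable {H : Type*} [NormedAddCommGroup H] [InnerProductSpace ℂ H]

/-- The algebraic full Fock space `⨁ₙ H^{⊗ n}` (no completion). -/
abbrev Fock (H : Type*) [NormedAddCommGroup H] [InnerProductSpace ℂ H] : Type _ :=
  ⨁ n : ℕ, ⨂[ℂ]^n H

/-- The inclusion of the `n`-th tensor power. -/
abbrev incl (n : ℕ) : (⨂[ℂ]^n H) →ₗ[ℂ] Fock H :=
  DirectSum.lof ℂ ℕ (fun n => ⨂[ℂ]^n H) n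

/-- The vacuum vector. -/
def vacuum (H : Type*) [NormedAddCommGroup H] [InnerProductSpace ℂ H] : Fock H :=
  incl 0 (PiTensorProduct.tprod ℂ (fun i : Fin 0 => i.elim0))

/-- The linear functional `y₁ ⊗ ⋯ ⊗ yₙ ↦ ∏ᵢ ⟨xᵢ, yᵢ⟩`. -/
def prodInner {n : ℕ} (x : Fin n → H) : (⨂[ℂ]^n H) →ₗ[ℂ] ℂ :=
  PiTensorProduct.lift
    ((MultilinearMap.mkPiAlgebra ℂ (Fin n) ℂ).compLinearMap (fun i => innerₛₗ ℂ (x i)))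

@[simp] theorem prodInner_tprod {n : ℕ} (x y : Fin n → H) :
    prodInner x (PiTensorProduct.tprod ℂ y) = ∏ i, ⟪x i, y i⟫_ℂ := by
  simp [prodInner]

/-- The antilinear functional `f ↦ conj ⟨y₁ ⊗ ⋯ ⊗ yₙ, f⟩`. -/
def conjProdInner {n : ℕ} (y : Fin n → H) : (⨂[ℂ]^n H) →ₗ⋆[ℂ] ℂ where
  toFun f := starRingEnd ℂ (prodInner y f)
  map_add' f g := by simp
  map_smul' c f := by simp

theorem conjProdInner_tprod {n : ℕ} (x y : Fin n → H) :
    conjProdInner y (PiTensorProduct.tprod ℂ x) = ∏ i, ⟪x i, y i⟫_ℂ := by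
  simp [conjProdInner]

theorem semilinear_ext {n : ℕ} {F G : (⨂[ℂ]^n H) →ₗ⋆[ℂ] ℂ}
    (h : ∀ x : Fin n → H, F (PiTensorProduct.tprod ℂ x) = G (PiTensorProduct.tprod ℂ x)) :
    F = G := by
  ext f
  induction f using PiTensorProduct.induction_on with
  | smul_tprod r x => simp [h]
  | add a b ha hb => simp [ha, hb]

/-- The inner product of the tensor power with its variables in reverse order. -/
def innerRev (n : ℕ) : (⨂[ℂ]^n H) →ₗ[ℂ] (⨂[ℂ]^n H) →ₗ⋆[ℂ] ℂ :=
  PiTensorProduct.lift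
    { toFun := conjProdInner
      map_update_add' := by
        intro _ y i u v
        refine semilinear_ext fun x => ?_
        simp only [LinearMap.add_apply, conjProdInner_tprod]
        rw [← Finset.mul_prod_erase _ _ (Finset.mem_univ i),
          ← Finset.mul_prod_erase _ _ (Finset.mem_univ i),
          ← Finset.mul_prod_erase _ _ (Finset.mem_univ i)]
        have hh : ∀ w : H, ∏ j ∈ Finset.univ.erase i, ⟪x j, Function.update y i w j⟫_ℂ
            = ∏ j ∈ Finset.univ.erase i, ⟪x j, y j⟫_ℂ := fun w =>
          Finset.prod_congr rfl fun j hj => by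
            rw [Function.update_of_ne (Finset.ne_of_mem_erase hj)]
        convert_to ⟪x i, Function.update y i (u + v) i⟫_ℂ * _ = _
        rw [hh, hh, hh]
        simp [add_mul]
      map_update_smul' := by
        intro _ y i c u
        refine semilinear_ext fun x => ?_
        simp only [LinearMap.smul_apply, conjProdInner_tprod]
        rw [← Finset.mul_prod_erase _ _ (Finset.mem_univ i),
          ← Finset.mul_prod_erase _ _ (Finset.mem_univ i)]
        have hh : ∀ w : H, ∏ j ∈ Finset.univ.erase i, ⟪x j, Function.update y i w j⟫_ℂ
            = ∏ j ∈ Finset.univ.erase i, ⟪x j, y j⟫_ℂ := fun w =>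
          Finset.prod_congr rfl fun j hj => by
            rw [Function.update_of_ne (Finset.ne_of_mem_erase hj)]
        convert_to ⟪x i, Function.update y i (c • u) i⟫_ℂ * _ = _
        rw [hh, hh]
        simp [mul_assoc] }

/-- The undeformed inner product `⟨x₁ ⊗ ⋯ ⊗ xₙ, y₁ ⊗ ⋯ ⊗ yₙ⟩_{0,0} = ∏ᵢ ⟨xᵢ, yᵢ⟩` of the `n`-th
tensor power, antilinear in the first variable. -/
def inner00 (n : ℕ) : (⨂[ℂ]^n H) →ₗ⋆[ℂ] (⨂[ℂ]^n H) →ₗ[ℂ] ℂ :=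
  (innerRev n).flip

theorem inner00_tprod {n : ℕ} (x y : Fin n → H) :
    inner00 n (PiTensorProduct.tprod ℂ x) (PiTensorProduct.tprod ℂ y) = ∏ i, ⟪x i, y i⟫_ℂ := by
  simp [inner00, innerRev, conjProdInner_tprod]

/-! ### The hyperoctahedral group and the type B symmetrization -/

/-- Elements of the hyperoctahedral group `Σ(n)`, written as signed arrangements: the pair
`(τ, ε)` stands for the sequence `ε₁ τ(1), …, εₙ τ(n)` of signed letters.
Applied to `x₁ ⊗ ⋯ ⊗ xₙ` it gives `x_{ε₁ τ(1)} ⊗ ⋯ ⊗ x_{εₙ τ(n)}`, where `x_{-k}` is the image of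
`x_k` under the involution. -/
abbrev SignedPerm (n : ℕ) : Type := Equiv.Perm (Fin n) × (Fin n → ℤˣ)

namespace SignedPerm

/-- The `i`-th signed letter `ε_i τ(i) ∈ {±1, …, ±n}`. -/
def letter {n : ℕ} (w : SignedPerm n) (i : Fin n) : ℤ :=
  (w.2 i : ℤ) * ((w.1 i : ℕ) + 1 : ℤ)

/-- The number of generators `π₀` in a reduced word: the number of negative letters.
See `reduced_count`. -/
def l₁ {n : ℕ} (w : SignedPerm n) : ℕ :=
  (Finset.univ.filter fun i : Fin n => w.2 i = -1).card

/-- The number of generators `π₁, …, π_{n-1}` in a reduced word: the number of inversions plus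
the number of pairs of letters with negative sum. See `reduced_count`. -/
def l₂ {n : ℕ} (w : SignedPerm n) : ℕ :=
  (Finset.univ.filter fun p : Fin n × Fin n => p.1 < p.2 ∧ w.letter p.2 < w.letter p.1).card +
  (Finset.univ.filter fun p : Fin n × Fin n => p.1 < p.2 ∧ w.letter p.1 + w.letter p.2 < 0).card

/-- The neutral element. -/
def one (n : ℕ) : SignedPerm n := (Equiv.refl _, fun _ => 1)

/-- Multiplication by the generator `π_a`, `0 ≤ a < n`: `π₀` changes the sign of the first letter
and `π_a` (`a ≥ 1`) exchanges the `a`-th and the `(a+1)`-st letter (counted from one). -/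
def gen {n : ℕ} (a : Fin n) (w : SignedPerm n) : SignedPerm n :=
  if a.1 = 0 then (w.1, Function.update w.2 a (-w.2 a))
  else
    let s : Equiv.Perm (Fin n) := Equiv.swap ⟨a.1 - 1, by omega⟩ a
    (s.trans w.1, w.2 ∘ s)

/-- The product `π_{a₁} ⋯ π_{a_l}`. -/
def ofWord {n : ℕ} (u : List (Fin n)) : SignedPerm n := u.foldr gen (one n)

/-- `u` is a word of minimal length for `w`. -/
def IsReduced {n : ℕ} (u : List (Fin n)) (w : SignedPerm n) : Prop :=
  ofWord u = w ∧ ∀ v : List (Fin n), ofWord v = w → u.length ≤ v.length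

end SignedPerm

/-- The action of a sign: the identity or the involution `J`. -/
def signMap (J : H →L[ℂ] H) (s : ℤˣ) : H →ₗ[ℂ] H :=
  if s = 1 then LinearMap.id else (J : H →ₗ[ℂ] H)

/-- The action of a signed permutation on the `n`-th tensor power. -/
def act (J : H →L[ℂ] H) {n : ℕ} (w : SignedPerm n) : (⨂[ℂ]^n H) →ₗ[ℂ] (⨂[ℂ]^n H) :=
  PiTensorProduct.map (fun i => signMap J (w.2 i)) ∘ₗ
    (PiTensorProduct.reindex ℂ (fun _ => H) w.1.symm).toLinearMap

theorem act_tprod (J : H →L[ℂ] H) {n : ℕ} (w : SignedPerm n) (x : Fin n → H) :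
    act J w (PiTensorProduct.tprod ℂ x) =
      PiTensorProduct.tprod ℂ (fun i => signMap J (w.2 i) (x (w.1 i))) := by
  simp [act]

/-- The type B symmetrization operator `P^{(n)}_{α,q} = ∑_σ α^{l₁(σ)} q^{l₂(σ)} σ`. -/
def symmetrization (α q : ℝ) (J : H →L[ℂ] H) (n : ℕ) : (⨂[ℂ]^n H) →ₗ[ℂ] (⨂[ℂ]^n H) :=
  ∑ w : SignedPerm n, ((α : ℂ) ^ w.l₁ * (q : ℂ) ^ w.l₂) • act J w

/-- The `(α,q)`-inner product on the algebraic full Fock space: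
`⟨f, g⟩_{α,q} = ∑ₙ ⟨fₙ, P^{(n)}_{α,q} gₙ⟩_{0,0}`, antilinear in `f`. -/
def fockInner (α q : ℝ) (J : H →L[ℂ] H) (f g : Fock H) : ℂ :=
  DirectSum.toAddMonoid
    (fun n => ((inner00 n).flip (symmetrization α q J n (g n))).toAddMonoidHom) f

theorem fockInner_incl (α q : ℝ) (J : H →L[ℂ] H) {n : ℕ} (f : ⨂[ℂ]^n H) (g : Fock H) :
    fockInner α q J (incl n f) g = inner00 n f (symmetrization α q J n (g n)) := by
  simp [fockInner, incl, DirectSum.lof_eq_of]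

/-! ### Creation, annihilation and gauge operators -/

/-- `x₁ ⊗ ⋯ ⊗ xₙ ↦ x₁ ⊗ ⋯ ⊗ xₙ ⊗ x`. -/
def create (x : H) (n : ℕ) : (⨂[ℂ]^n H) →ₗ[ℂ] (⨂[ℂ]^(n + 1) H) :=
  (PiTensorProduct.lift
    (PiTensorProduct.tprod ℂ (s := fun _ : Fin (n + 1) => H)).curryRight).flip x

theorem create_tprod (x : H) {n : ℕ} (y : Fin n → H) :
    create x n (PiTensorProduct.tprod ℂ y) =
      PiTensorProduct.tprod ℂ (Fin.snoc y x : Fin (n + 1) → H) := by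
  simp [create]

/-- `x₀ ⊗ ⋯ ⊗ xₙ ↦ φ(x_k) x₀ ⊗ ⋯ x̌_k ⋯ ⊗ xₙ`. -/
def contract {n : ℕ} (k : Fin (n + 1)) (φ : H →ₗ[ℂ] ℂ) :
    (⨂[ℂ]^(n + 1) H) →ₗ[ℂ] (⨂[ℂ]^n H) :=
  PiTensorProduct.lift
    (LinearMap.uncurryMid k
      (φ.smulRight (PiTensorProduct.tprod ℂ (s := fun _ : Fin n => H))))

theorem contract_tprod {n : ℕ} (k : Fin (n + 1)) (φ : H →ₗ[ℂ] ℂ) (y : Fin (n + 1) → H) :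
    contract k φ (PiTensorProduct.tprod ℂ y) =
      φ (y k) • PiTensorProduct.tprod ℂ (fun i => y (k.succAbove i)) := by
  simp only [contract, PiTensorProduct.lift.tprod, LinearMap.uncurryMid_apply]
  rfl

/-- `x₀ ⊗ ⋯ ⊗ xₙ ↦ x₀ ⊗ ⋯ x̌_k ⋯ ⊗ xₙ ⊗ x_k`. -/
def toLast {n : ℕ} (k : Fin (n + 1)) : (⨂[ℂ]^(n + 1) H) →ₗ[ℂ] (⨂[ℂ]^(n + 1) H) :=
  (PiTensorProduct.reindex ℂ (fun _ => H)
    ((finSuccEquiv' k).trans (finSuccEquiv' (Fin.last n)).symm)).toLinearMap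

theorem toLast_tprod {n : ℕ} (k : Fin (n + 1)) (y : Fin (n + 1) → H) :
    toLast k (PiTensorProduct.tprod ℂ y) =
      PiTensorProduct.tprod ℂ
        (Fin.snoc (fun i => y (k.succAbove i)) (y k) : Fin (n + 1) → H) := by
  simp only [toLast, LinearEquiv.coe_coe, PiTensorProduct.reindex_tprod]
  congr 1
  funext i
  refine Fin.lastCases ?_ (fun j => ?_) i
  · simp
  · simp only [Equiv.symm_trans_apply, Equiv.symm_symm, Fin.snoc_castSucc]
    rw [← Fin.succAbove_last_apply, finSuccEquiv'_succAbove, finSuccEquiv'_symm_some]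

/-- `p₀(A)`: apply `A` to the last tensor factor. -/
def onLast (A : H →L[ℂ] H) (n : ℕ) : (⨂[ℂ]^(n + 1) H) →ₗ[ℂ] (⨂[ℂ]^(n + 1) H) :=
  PiTensorProduct.map (Fin.snoc (fun _ : Fin n => LinearMap.id) (A : H →ₗ[ℂ] H))

theorem onLast_tprod (A : H →L[ℂ] H) {n : ℕ} (y : Fin n → H) (z : H) :
    onLast A n (PiTensorProduct.tprod ℂ (Fin.snoc y z : Fin (n + 1) → H)) =
      PiTensorProduct.tprod ℂ (Fin.snoc y (A z) : Fin (n + 1) → H) := by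
  simp only [onLast, PiTensorProduct.map_tprod]
  congr 1
  funext i
  refine Fin.lastCases ?_ (fun j => ?_) i
  · simp
  · simp

/-- The operator `R^{(n+1)}_{α,q}` on `H^{⊗ (n+1)}`:
`x₀ ⊗ ⋯ ⊗ xₙ ↦ ∑_k q^{n-k} x₀ ⊗ ⋯ x̌_k ⋯ ⊗ xₙ ⊗ x_k
  + α qⁿ ∑_k q^k x₀ ⊗ ⋯ x̌_k ⋯ ⊗ xₙ ⊗ J x_k`. -/
def opR (α q : ℝ) (J : H →L[ℂ] H) (n : ℕ) : (⨂[ℂ]^(n + 1) H) →ₗ[ℂ] (⨂[ℂ]^(n + 1) H) :=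
  (∑ k : Fin (n + 1), (q : ℂ) ^ (n - (k : ℕ)) • toLast k) +
    ((α : ℂ) * (q : ℂ) ^ n) •
      ∑ k : Fin (n + 1), (q : ℂ) ^ (k : ℕ) • (onLast J n ∘ₗ toLast k)

/-- `r_q(x)` on `H^{⊗ (n+1)}`: `∑_k q^{n-k} ⟨x, x_k⟩ x₀ ⊗ ⋯ x̌_k ⋯ ⊗ xₙ`. -/
def opr (q : ℝ) (x : H) (n : ℕ) : (⨂[ℂ]^(n + 1) H) →ₗ[ℂ] (⨂[ℂ]^n H) :=
  ∑ k : Fin (n + 1), (q : ℂ) ^ (n - (k : ℕ)) • contract k (innerₛₗ ℂ x)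

/-- `ℓ^N_q(x)` on `H^{⊗ (n+1)}`: `qⁿ ∑_k q^k ⟨x, J x_k⟩ x₀ ⊗ ⋯ x̌_k ⋯ ⊗ xₙ`. -/
def opl (q : ℝ) (J : H →L[ℂ] H) (x : H) (n : ℕ) : (⨂[ℂ]^(n + 1) H) →ₗ[ℂ] (⨂[ℂ]^n H) :=
  (q : ℂ) ^ n •
    ∑ k : Fin (n + 1), (q : ℂ) ^ (k : ℕ) • contract k (innerₛₗ ℂ x ∘ₗ (J : H →ₗ[ℂ] H))

/-- The annihilation operator `b_{α,q}(x) = r_q(x) + α ℓ^N_q(x)` on Fock space; it kills the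
vacuum. -/
def annihilation (α q : ℝ) (J : H →L[ℂ] H) (x : H) : Module.End ℂ (Fock H) :=
  DirectSum.toModule ℂ ℕ (Fock H) fun n =>
    match n with
    | 0 => 0
    | n + 1 => incl n ∘ₗ (opr q x n + (α : ℂ) • opl q J x n)

/-- The creation operator `b*_{α,q}(x)`: `x₁ ⊗ ⋯ ⊗ xₙ ↦ x₁ ⊗ ⋯ ⊗ xₙ ⊗ x` and `Ω ↦ x`.
It is the adjoint of `b_{α,q}(x)` for the `(α,q)`-inner product: see
`fockInner_creation_left`. -/
def creation (x : H) : Module.End ℂ (Fock H) :=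
  DirectSum.toModule ℂ ℕ (Fock H) fun n => incl (n + 1) ∘ₗ create x n

/-- The gauge operator `p(A)`: `p(A) Ω = 0` and `p(A) = p₀(A) R^{(n)}_{α,q}` on `H^{⊗ n}`,
`n ≥ 1`. -/
def gaugeOperator (α q : ℝ) (J : H →L[ℂ] H) (A : H →L[ℂ] H) : Module.End ℂ (Fock H) :=
  DirectSum.toModule ℂ ℕ (Fock H) fun n =>
    match n with
    | 0 => 0
    | n + 1 => incl (n + 1) ∘ₗ onLast A n ∘ₗ opR α q J n

/-- The vacuum state `φ_{α,q}(X) = ⟨Ω, X Ω⟩_{α,q}`. -/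
def vacuumState (α q : ℝ) (J : H →L[ℂ] H) (X : Module.End ℂ (Fock H)) : ℂ :=
  fockInner α q J (vacuum H) (X (vacuum H))

/-- The type B operator `B^λ_{α,q}(x) = b_{α,q}(x) + b*_{α,q}(x) + p(A) + λ I`; it is used with
`A = T_x`. -/
def typeBOperator (α q : ℝ) (J : H →L[ℂ] H) (lam : ℝ) (A : H →L[ℂ] H) (x : H) :
    Module.End ℂ (Fock H) :=
  annihilation α q J x + creation x + gaugeOperator α q J A + (lam : ℂ) • 1


namespace SignedPerm

theorem sign_cases (s : ℤˣ) : s = 1 ∨ s = -1 := Int.units_eq_one_or s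

theorem letter_gen_zero {n : ℕ} (a : Fin n) (h : a.1 = 0) (w : SignedPerm n) (i : Fin n) :
    (gen a w).letter i = if i = a then - w.letter i else w.letter i := by
  by_cases hi : i = a
  · subst hi; simp [gen, h, letter]
  · simp [gen, h, letter, hi]

theorem gen_of_ne {n : ℕ} (a : Fin n) (h : a.1 ≠ 0) (w : SignedPerm n) :
    gen a w = ((Equiv.swap ⟨a.1 - 1, by omega⟩ a).trans w.1,
      w.2 ∘ (Equiv.swap ⟨a.1 - 1, by omega⟩ a : Equiv.Perm (Fin n))) := by
  simp [gen, h]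

theorem letter_gen_ne {n : ℕ} (a : Fin n) (h : a.1 ≠ 0) (w : SignedPerm n) (i : Fin n) :
    (gen a w).letter i = w.letter (Equiv.swap ⟨a.1 - 1, by omega⟩ a i) := by
  rw [gen_of_ne a h]; rfl

theorem gen_gen {n : ℕ} (a : Fin n) (w : SignedPerm n) : gen a (gen a w) = w := by
  by_cases h : a.1 = 0
  · refine Prod.ext ?_ ?_
    · simp [gen, h]
    · funext i
      by_cases hi : i = a
      · subst hi; simp [gen, h]
      · simp [gen, h]
  · rw [gen_of_ne a h, gen_of_ne a h]
    refine Prod.ext ?_ ?_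
    · ext i; simp
    · funext i; simp

theorem letter_ne_zero {n : ℕ} (w : SignedPerm n) (i : Fin n) : w.letter i ≠ 0 := by
  rcases sign_cases (w.2 i) with h | h <;> simp [letter, h] <;> omega

theorem letter_ne {n : ℕ} (w : SignedPerm n) {i j : Fin n} (hij : i ≠ j) :
    w.letter i ≠ w.letter j ∧ w.letter i + w.letter j ≠ 0 := by
  have : (w.1 i : ℕ) ≠ w.1 j := fun h => hij (w.1.injective (Fin.ext h))
  rcases sign_cases (w.2 i) with h | h <;> rcases sign_cases (w.2 j) with h' | h' <;>
    simp [letter, h, h'] <;> omega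

/-- `l₂` as a sum over pairs. -/
theorem l₂_eq {n : ℕ} (w : SignedPerm n) :
    w.l₂ = ∑ p : Fin n × Fin n, if p.1 < p.2 then
      (if w.letter p.2 < w.letter p.1 then 1 else 0) +
      (if w.letter p.1 + w.letter p.2 < 0 then 1 else 0) else 0 := by
  rw [l₂, Finset.card_filter, Finset.card_filter, ← Finset.sum_add_distrib]
  refine Finset.sum_congr rfl fun p _ => ?_
  by_cases h : p.1 < p.2 <;> simp [h]

theorem l₁_eq {n : ℕ} (w : SignedPerm n) :
    w.l₁ = ∑ i : Fin n, if w.2 i = -1 then 1 else 0 := by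
  rw [l₁, Finset.card_filter]

theorem l₂_gen_zero {n : ℕ} (a : Fin n) (h : a.1 = 0) (w : SignedPerm n) :
    (gen a w).l₂ = w.l₂ := by
  rw [l₂_eq, l₂_eq]
  refine Finset.sum_congr rfl fun p _ => ?_
  by_cases hp : p.1 < p.2
  · have h2 : p.2 ≠ a := by
      intro hh; rw [hh] at hp; have := Fin.lt_def.1 hp; omega
    have hn := letter_ne w (ne_of_lt hp)
    simp only [letter_gen_zero a h, hp, if_true, if_neg h2]
    by_cases h1 : p.1 = a
    · simp only [h1, if_true] at *
      split_ifs <;> omega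
    · simp only [h1, if_false]
  · simp [hp]

theorem l₁_gen_zero {n : ℕ} (a : Fin n) (h : a.1 = 0) (w : SignedPerm n) :
    (w.2 a = 1 → (gen a w).l₁ = w.l₁ + 1) ∧ (w.2 a = -1 → (gen a w).l₁ + 1 = w.l₁) := by
  rw [l₁_eq, l₁_eq, ← Finset.add_sum_erase _ _ (Finset.mem_univ a),
    ← Finset.add_sum_erase _ (fun i => if w.2 i = -1 then 1 else 0) (Finset.mem_univ a)]
  have e : ∑ x ∈ Finset.univ.erase a, (if (gen a w).2 x = -1 then 1 else 0)
      = ∑ x ∈ Finset.univ.erase a, (if w.2 x = -1 then 1 else 0) := by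
    refine Finset.sum_congr rfl fun i hi => ?_
    simp [gen, h, Finset.ne_of_mem_erase hi]
  rw [e]
  have e2 : (gen a w).2 a = - w.2 a := by simp [gen, h]
  rw [e2]
  have h1 : (1 : ℤˣ) ≠ -1 := by decide
  constructor <;> intro hh <;> rw [hh] <;> simp [h1] <;> omega

theorem l₁_gen_ne {n : ℕ} (a : Fin n) (h : a.1 ≠ 0) (w : SignedPerm n) :
    (gen a w).l₁ = w.l₁ := by
  rw [l₁_eq, l₁_eq, gen_of_ne a h]
  exact Equiv.sum_comp (Equiv.swap (⟨a.1 - 1, by omega⟩ : Fin n) a)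
    (fun i => if w.2 i = -1 then 1 else 0)

theorem l₂_gen_ne {n : ℕ} (a : Fin n) (h : a.1 ≠ 0) (w : SignedPerm n) :
    (w.letter ⟨a.1 - 1, by omega⟩ < w.letter a → (gen a w).l₂ = w.l₂ + 1) ∧
    (w.letter a < w.letter ⟨a.1 - 1, by omega⟩ → (gen a w).l₂ + 1 = w.l₂) := by
  set b : Fin n := ⟨a.1 - 1, by omega⟩ with hb
  have hba : b < a := by rw [Fin.lt_def]; simp [hb]; omega
  set s : Equiv.Perm (Fin n) := Equiv.swap b a with hs
  set F : Fin n × Fin n → ℕ := fun p => if p.1 < p.2 then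
      (if w.letter p.2 < w.letter p.1 then 1 else 0) +
      (if w.letter p.1 + w.letter p.2 < 0 then 1 else 0) else 0 with hF
  set G : Fin n × Fin n → ℕ := fun p => if s p.1 < s p.2 then
      (if w.letter p.2 < w.letter p.1 then 1 else 0) +
      (if w.letter p.1 + w.letter p.2 < 0 then 1 else 0) else 0 with hG
  have e1 : w.l₂ = ∑ p, F p := l₂_eq w
  have e2 : (gen a w).l₂ = ∑ p, G p := by
    rw [l₂_eq, ← Equiv.sum_comp (s.prodCongr s) G]
    refine Finset.sum_congr rfl fun p _ => ?_
    simp [hG, letter_gen_ne a h, hs, ← hb]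
  have hne : (b, a) ≠ (a, b) := by
    intro hh; exact absurd (congrArg Prod.fst hh) (ne_of_lt hba)
  have split : ∀ K : Fin n × Fin n → ℕ, ∑ p, K p =
      K (b, a) + (K (a, b) + ∑ p ∈ (Finset.univ.erase (b, a)).erase (a, b), K p) := by
    intro K
    rw [← Finset.add_sum_erase _ K (Finset.mem_univ (b, a)),
      ← Finset.add_sum_erase (Finset.univ.erase (b, a)) K
        (Finset.mem_erase.2 ⟨hne.symm, Finset.mem_univ _⟩)]
  have rest : ∑ p ∈ (Finset.univ.erase (b, a)).erase (a, b), G p =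
      ∑ p ∈ (Finset.univ.erase (b, a)).erase (a, b), F p := by
    refine Finset.sum_congr rfl fun p hp => ?_
    obtain ⟨i, j⟩ := p
    have hp1 : ¬ (i = a ∧ j = b) := by
      rintro ⟨rfl, rfl⟩; simp at hp
    have hp2 : ¬ (i = b ∧ j = a) := by
      rintro ⟨rfl, rfl⟩; simp at hp
    have key : (s i < s j) ↔ (i < j) := by
      simp only [hs, Equiv.swap_apply_def]
      have hbv : b.1 + 1 = a.1 := by simp [hb]; omega
      simp only [Fin.ext_iff, Fin.lt_def] at *
      split_ifs <;> omega
    simp only [hF, hG, key]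
  rw [e1, e2, split G, split F, rest]
  have hab : ¬ a < b := not_lt.2 hba.le
  have sb : s b = a := by simp [hs]
  have sa : s a = b := by simp [hs]
  have hn := letter_ne w (ne_of_lt hba)
  simp only [hF, hG, sa, sb, hba, hab, if_true, if_false]
  rw [add_comm (w.letter a) (w.letter b)]
  constructor <;> intro hh
  · simp only [hh, if_true, not_lt.2 hh.le, if_false]; omega
  · simp only [hh, if_true, not_lt.2 hh.le, if_false]; omega

theorem l₁_one (n : ℕ) : (one n).l₁ = 0 := by
  have h1 : (1 : ℤˣ) ≠ -1 := by decide
  simp [l₁, one, h1]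

theorem l₂_one (n : ℕ) : (one n).l₂ = 0 := by
  rw [l₂_eq]
  refine Finset.sum_eq_zero fun p _ => ?_
  by_cases hp : p.1 < p.2
  · have := Fin.lt_def.1 hp
    simp only [hp, if_true, letter, one, Equiv.refl_apply, Units.val_one, one_mul]
    split_ifs <;> omega
  · simp [hp]

/-- Every word for `w` has at least `l₁ w` letters `π₀` and `l₂ w` other letters. -/
theorem le_count {n : ℕ} (u : List (Fin n)) :
    (ofWord u).l₁ ≤ u.countP (fun a => a.1 = 0) ∧
    (ofWord u).l₂ ≤ u.countP (fun a => a.1 ≠ 0) := by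
  induction u with
  | nil => simp [ofWord, l₁_one, l₂_one]
  | cons a u ih =>
    have e : ofWord (a :: u) = gen a (ofWord u) := rfl
    rw [e]
    by_cases h : a.1 = 0
    · have h1 := l₁_gen_zero a h (ofWord u)
      rw [l₂_gen_zero a h]
      rw [List.countP_cons_of_pos (by simpa using h), List.countP_cons_of_neg (by simpa using h)]
      rcases sign_cases ((ofWord u).2 a) with hs | hs
      · have := h1.1 hs; omega
      · have := h1.2 hs; omega
    · have h2 := l₂_gen_ne a h (ofWord u)
      rw [l₁_gen_ne a h]
      rw [List.countP_cons_of_neg (by simpa using h), List.countP_cons_of_pos (by simpa using h)]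
      have hne := (letter_ne (ofWord u) (i := a) (j := ⟨a.1 - 1, by omega⟩)
        (by intro hh; have := congrArg Fin.val hh; simp at this; omega)).1
      rcases lt_or_gt_of_ne hne with hs | hs
      · have := h2.2 hs; omega
      · have := h2.1 hs; omega

/-- An arrangement with positive first letter and increasing letters is the neutral element. -/
theorem eq_one_of_increasing {n : ℕ} (w : SignedPerm n)
    (h0 : ∀ a : Fin n, a.1 = 0 → w.2 a = 1)
    (h1 : ∀ a : Fin n, a.1 ≠ 0 → w.letter ⟨a.1 - 1, by omega⟩ < w.letter a) :
    w = one n := by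
  have hpos : ∀ m : ℕ, ∀ hm : m < n, ((m : ℤ) + 1) ≤ w.letter ⟨m, hm⟩ := by
    intro m
    induction m with
    | zero => intro hm; simp [letter, h0 ⟨0, hm⟩ rfl]
    | succ m ih =>
      intro hm
      have a := ih (by omega)
      have b := h1 ⟨m + 1, hm⟩ (by simp)
      simp only [Nat.add_sub_cancel] at b
      push_cast; omega
  have hsign : ∀ i, w.2 i = 1 := by
    intro i
    rcases sign_cases (w.2 i) with h | h
    · exact h
    · have := hpos i.1 i.2
      simp [letter, h] at this
      omega
  have hle : ∀ i : Fin n, i ≤ w.1 i := by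
    intro i
    have := hpos i.1 i.2
    simp [letter, hsign] at this
    exact this
  have hid : ∀ i : Fin n, w.1 i = i := by
    intro i
    have hsum : ∑ j : Fin n, (w.1 j : ℕ) = ∑ j : Fin n, (j : ℕ) :=
      Equiv.sum_comp w.1 (fun j : Fin n => (j : ℕ))
    have := (Finset.sum_eq_sum_iff_of_le (s := Finset.univ) (f := fun j : Fin n => (j : ℕ))
      (g := fun j => (w.1 j : ℕ)) (fun j _ => hle j)).1 hsum.symm i (Finset.mem_univ i)
    exact Fin.ext this.symm
  refine Prod.ext (Equiv.ext fun i => ?_) (funext fun i => ?_)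
  · simpa [one] using hid i
  · simpa [one] using hsign i

/-- Every `w` has a word of length `l₁ w + l₂ w`. -/
theorem exists_word {n : ℕ} : ∀ (m : ℕ) (w : SignedPerm n), w.l₁ + w.l₂ = m →
    ∃ u : List (Fin n), ofWord u = w ∧ u.length = m := by
  intro m
  induction m with
  | zero =>
    intro w hw
    refine ⟨[], ?_, rfl⟩
    refine (eq_one_of_increasing w ?_ ?_).symm
    · intro a ha
      rcases sign_cases (w.2 a) with h | h
      · exact h
      · have := (l₁_gen_zero a ha w).2 h; omega
    · intro a ha
      have hne := (letter_ne w (i := ⟨a.1 - 1, by omega⟩) (j := a)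
        (by intro hh; have := congrArg Fin.val hh; simp at this; omega)).1
      rcases lt_or_gt_of_ne hne with h | h
      · exact h
      · have := (l₂_gen_ne a ha w).2 h; omega
  | succ m ih =>
    intro w hw
    by_cases hc : ∃ a : Fin n, (gen a w).l₁ + (gen a w).l₂ = m
    · obtain ⟨a, ha⟩ := hc
      obtain ⟨u, hu, hl⟩ := ih _ ha
      refine ⟨a :: u, ?_, by simp [hl]⟩
      have e : ofWord (a :: u) = gen a (ofWord u) := rfl
      rw [e, hu, gen_gen]
    · exfalso
      push Not at hc
      have : w = one n := by
        refine eq_one_of_increasing w ?_ ?_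
        · intro a ha
          rcases sign_cases (w.2 a) with h | h
          · exact h
          · have := (l₁_gen_zero a ha w).2 h
            have h2 := l₂_gen_zero a ha w
            exact absurd (by omega) (hc a)
        · intro a ha
          have hne := (letter_ne w (i := ⟨a.1 - 1, by omega⟩) (j := a)
            (by intro hh; have := congrArg Fin.val hh; simp at this; omega)).1
          rcases lt_or_gt_of_ne hne with h | h
          · exact h
          · have := (l₂_gen_ne a ha w).2 h
            have h2 := l₁_gen_ne a ha w
            exact absurd (by omega) (hc a)
      rw [this, l₁_one, l₂_one] at hw
      omega

/-- In every word of minimal length for `w` the generator `π₀` occurs `l₁ w` times and the other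
generators occur `l₂ w` times. -/
theorem reduced_count {n : ℕ} {u : List (Fin n)} {w : SignedPerm n} (h : IsReduced u w) :
    u.countP (fun a => a.1 = 0) = w.l₁ ∧ u.countP (fun a => a.1 ≠ 0) = w.l₂ := by
  obtain ⟨h1, h2⟩ := h
  obtain ⟨v, hv, hl⟩ := exists_word _ w rfl
  have a := h2 v hv
  have b := le_count u
  rw [h1] at b
  have c : u.length = u.countP (fun a => a.1 = 0) + u.countP (fun a => a.1 ≠ 0) := by
    rw [List.length_eq_countP_add_countP (fun a : Fin n => a.1 = 0)]
    congr 2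
    funext a; simp
  omega

end SignedPerm

/-- A product of generators acts factor by factor: `π₀` applies the involution to the first
factor and `π_a`, `a ≥ 1`, exchanges two neighbouring factors. -/
theorem act_gen_zero (J : H →L[ℂ] H) (hJ : ∀ z, J (J z) = z) {n : ℕ} (a : Fin n) (ha : a.1 = 0)
    (w : SignedPerm n) (x : Fin n → H) :
    act J (SignedPerm.gen a w) (PiTensorProduct.tprod ℂ x) =
      PiTensorProduct.map (fun i => if i = a then (J : H →ₗ[ℂ] H) else LinearMap.id)
        (act J w (PiTensorProduct.tprod ℂ x)) := by
  simp only [act_tprod, PiTensorProduct.map_tprod]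
  congr 1
  funext i
  have h2 : (-1 : ℤˣ) ≠ 1 := by decide
  by_cases hi : i = a
  · subst hi
    rcases Int.units_eq_one_or (w.2 i) with h | h <;>
      simp [SignedPerm.gen, ha, signMap, h, h2, hJ]
  · simp [SignedPerm.gen, ha, hi]

theorem act_gen_ne (J : H →L[ℂ] H) {n : ℕ} (a : Fin n) (ha : a.1 ≠ 0)
    (w : SignedPerm n) (x : Fin n → H) :
    act J (SignedPerm.gen a w) (PiTensorProduct.tprod ℂ x) =
      PiTensorProduct.reindex ℂ (fun _ => H) (Equiv.swap (⟨a.1 - 1, by omega⟩ : Fin n) a)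
        (act J w (PiTensorProduct.tprod ℂ x)) := by
  rw [SignedPerm.gen_of_ne a ha]
  simp only [act_tprod, PiTensorProduct.reindex_tprod]
  rfl

/-! ### The creation operator is the adjoint of the annihilation operator -/

namespace SignedPerm

/-- The arrangement whose last letter is `s k` and whose other letters are those of `w`, with the
letters `1, …, n` renamed increasingly to the letters different from `k`. -/
def extend {n : ℕ} (k : Fin (n + 1)) (s : ℤˣ) (w : SignedPerm n) : SignedPerm (n + 1) :=
  (((finSuccEquiv' (Fin.last n)).trans w.1.optionCongr).trans (finSuccEquiv' k).symm,
    Fin.snoc w.2 s)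

theorem extend_last {n : ℕ} (k : Fin (n + 1)) (s : ℤˣ) (w : SignedPerm n) :
    (extend k s w).1 (Fin.last n) = k := by
  simp [extend]

theorem extend_castSucc {n : ℕ} (k : Fin (n + 1)) (s : ℤˣ) (w : SignedPerm n) (i : Fin n) :
    (extend k s w).1 i.castSucc = k.succAbove (w.1 i) := by
  simp only [extend, Equiv.trans_apply]
  rw [← Fin.succAbove_last_apply, finSuccEquiv'_succAbove]
  simp

theorem extend_sign_last {n : ℕ} (k : Fin (n + 1)) (s : ℤˣ) (w : SignedPerm n) :
    (extend k s w).2 (Fin.last n) = s := by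
  simp [extend]

theorem extend_sign_castSucc {n : ℕ} (k : Fin (n + 1)) (s : ℤˣ) (w : SignedPerm n)
    (i : Fin n) : (extend k s w).2 i.castSucc = w.2 i := by
  simp [extend]

theorem extend_bijective (n : ℕ) : Function.Bijective
    (fun t : (Fin (n + 1) × ℤˣ) × SignedPerm n => extend t.1.1 t.1.2 t.2) := by
  rw [Fintype.bijective_iff_injective_and_card]
  constructor
  · rintro ⟨⟨k, s⟩, w⟩ ⟨⟨k', s'⟩, w'⟩ h
    have h' : extend k s w = extend k' s' w' := h
    have hk : k = k' := by rw [← extend_last k s w, h', extend_last]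
    subst hk
    have hs : s = s' := by
      have := congrFun (congrArg Prod.snd h') (Fin.last n)
      simpa [extend] using this
    have hw : w = w' := by
      refine Prod.ext (Equiv.ext fun i => ?_) (funext fun i => ?_)
      · have := extend_castSucc k s w i
        rw [h', extend_castSucc] at this
        exact (Fin.succAbove_right_injective this).symm
      · have := congrFun (congrArg Prod.snd h') i.castSucc
        simpa [extend] using this
    rw [hs, hw]
  · simp [Fintype.card_perm, Nat.factorial_succ, pow_succ]
    ring

theorem l₁_extend {n : ℕ} (k : Fin (n + 1)) (s : ℤˣ) (w : SignedPerm n) :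
    (extend k s w).l₁ = w.l₁ + if s = -1 then 1 else 0 := by
  rw [l₁_eq, l₁_eq, Fin.sum_univ_castSucc]
  simp [extend]

theorem letter_extend_last {n : ℕ} (k : Fin (n + 1)) (s : ℤˣ) (w : SignedPerm n) :
    (extend k s w).letter (Fin.last n) = (s : ℤ) * ((k : ℕ) + 1 : ℤ) := by
  simp only [letter, extend_last]
  simp [extend]

theorem letter_extend_castSucc {n : ℕ} (k : Fin (n + 1)) (s : ℤˣ) (w : SignedPerm n)
    (i : Fin n) : (extend k s w).letter i.castSucc =
      (w.2 i : ℤ) * (((k.succAbove (w.1 i) : Fin (n + 1)) : ℕ) + 1 : ℤ) := by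
  simp only [letter, extend_castSucc]
  simp [extend]

theorem succAbove_val {n : ℕ} (k : Fin (n + 1)) (i : Fin n) :
    ((k.succAbove i : Fin (n + 1)) : ℕ) = if (i : ℕ) < k then (i : ℕ) else i + 1 := by
  simp only [Fin.succAbove, Fin.lt_def, Fin.val_castSucc]
  split_ifs <;> simp

theorem sum_pairs {n : ℕ} (F : Fin (n + 1) → Fin (n + 1) → ℕ) :
    (∑ p : Fin (n + 1) × Fin (n + 1), if p.1 < p.2 then F p.1 p.2 else 0) =
      (∑ p : Fin n × Fin n, if p.1 < p.2 then F p.1.castSucc p.2.castSucc else 0) +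
        ∑ i : Fin n, F i.castSucc (Fin.last n) := by
  rw [Fintype.sum_prod_type, Fintype.sum_prod_type, Fin.sum_univ_castSucc]
  simp only [Fin.sum_univ_castSucc, Fin.castSucc_lt_castSucc_iff, Fin.castSucc_lt_last, if_true,
    lt_self_iff_false, if_false, Finset.sum_add_distrib, add_zero, add_assoc]
  have : ∀ i : Fin n, ¬ Fin.last n < i.castSucc := fun i => not_lt.2 (Fin.le_last _)
  simp [this]

theorem sum_lt (n m : ℕ) (hm : m ≤ n) :
    (∑ i : Fin n, if (i : ℕ) < m then 1 else 0) = m := by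
  rw [Fin.sum_univ_eq_sum_range (fun i => if i < m then 1 else 0) n, ← Finset.card_filter]
  have : (Finset.range n).filter (fun i => i < m) = Finset.range m := by
    ext i; simp; omega
  rw [this, Finset.card_range]

theorem l₂_extend {n : ℕ} (k : Fin (n + 1)) (s : ℤˣ) (w : SignedPerm n) :
    (extend k s w).l₂ = w.l₂ + if s = -1 then n + k else n - k := by
  rw [l₂_eq, l₂_eq, sum_pairs (fun i j =>
    (if (extend k s w).letter j < (extend k s w).letter i then 1 else 0) +
      (if (extend k s w).letter i + (extend k s w).letter j < 0 then 1 else 0))]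
  congr 1
  · refine Finset.sum_congr rfl fun p _ => ?_
    by_cases hp : p.1 < p.2
    · have hne : (w.1 p.1 : ℕ) ≠ w.1 p.2 := fun h =>
        (ne_of_lt hp) (w.1.injective (Fin.ext h))
      simp only [hp, if_true, letter_extend_castSucc, succAbove_val]
      rcases sign_cases (w.2 p.1) with h | h <;> rcases sign_cases (w.2 p.2) with h' | h' <;>
        simp only [letter, h, h', Units.val_one, Units.val_neg, one_mul, neg_mul] <;>
        (congr 1 <;> (apply if_congr _ rfl rfl; split_ifs <;> push_cast <;> omega))
    · simp [hp]
  · have hk : (k : ℕ) ≤ n := Nat.lt_succ_iff.1 k.2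
    have base := sum_lt n k hk
    have e : ∑ i : Fin n, (if (w.1 i : ℕ) < k then 1 else 0) = (k : ℕ) := by
      exact (Equiv.sum_comp w.1 (fun i : Fin n => if (i : ℕ) < k then 1 else 0)).trans base
    have h1 : (1 : ℤˣ) ≠ -1 := by decide
    simp only [letter_extend_castSucc, letter_extend_last, succAbove_val]
    rcases sign_cases s with hs | hs
    · have : ∀ i : Fin n, _ + (if (w.1 i : ℕ) < k then 1 else 0) = 1 := fun i => by
        refine (?_ : ((if (s : ℤ) * ((k : ℕ) + 1 : ℤ) < (w.2 i : ℤ) *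
            ((((if (w.1 i : ℕ) < k then (w.1 i : ℕ) else w.1 i + 1) : ℕ) : ℤ) + 1) then 1 else 0) +
          (if (w.2 i : ℤ) * ((((if (w.1 i : ℕ) < k then (w.1 i : ℕ) else w.1 i + 1) : ℕ) : ℤ) + 1)
            + (s : ℤ) * ((k : ℕ) + 1 : ℤ) < 0 then 1 else 0)) + _ = 1)
        rcases sign_cases (w.2 i) with h | h <;> by_cases hik : (w.1 i : ℕ) < k <;>
          simp only [h, hs, hik, if_true, if_false, Units.val_one, Units.val_neg, one_mul,
            neg_mul] <;> split_ifs <;> push_cast at * <;> omega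
      have t := Finset.sum_congr (rfl : (Finset.univ : Finset (Fin n)) = _) fun i _ => this i
      rw [Finset.sum_add_distrib, e] at t
      simp only [Finset.sum_const, Finset.card_univ, Fintype.card_fin, smul_eq_mul, mul_one] at t
      rw [hs, if_neg h1, ← hs]
      omega
    · have : ∀ i : Fin n, _ = 1 + (if (w.1 i : ℕ) < k then 1 else 0) := fun i => by
        refine (?_ : ((if (s : ℤ) * ((k : ℕ) + 1 : ℤ) < (w.2 i : ℤ) *
            ((((if (w.1 i : ℕ) < k then (w.1 i : ℕ) else w.1 i + 1) : ℕ) : ℤ) + 1) then 1 else 0) +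
          (if (w.2 i : ℤ) * ((((if (w.1 i : ℕ) < k then (w.1 i : ℕ) else w.1 i + 1) : ℕ) : ℤ) + 1)
            + (s : ℤ) * ((k : ℕ) + 1 : ℤ) < 0 then 1 else 0)) = _)
        rcases sign_cases (w.2 i) with h | h <;> by_cases hik : (w.1 i : ℕ) < k <;>
          simp only [h, hs, hik, if_true, if_false, Units.val_one, Units.val_neg, one_mul,
            neg_mul] <;> split_ifs <;> push_cast at * <;> omega
      rw [if_pos hs, Finset.sum_congr rfl fun i _ => this i, Finset.sum_add_distrib, e]
      simp

end SignedPerm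

theorem inner00_create (x : H) {n : ℕ} (f : ⨂[ℂ]^n H) (y : Fin (n + 1) → H) :
    inner00 (n + 1) (create x n f) (PiTensorProduct.tprod ℂ y) =
      ⟪x, y (Fin.last n)⟫_ℂ * inner00 n f (PiTensorProduct.tprod ℂ (fun i => y i.castSucc)) := by
  induction f using PiTensorProduct.induction_on with
  | smul_tprod r z =>
    simp only [map_smul, LinearMap.map_smulₛₗ, LinearMap.smul_apply, create_tprod, inner00_tprod,
      Fin.prod_univ_castSucc, Fin.snoc_castSucc, Fin.snoc_last, smul_eq_mul]
    ring
  | add a b ha hb =>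
    simp only [map_add, LinearMap.add_apply, ha, hb]; ring

theorem inner00_create_symmetrization (α q : ℝ) (J : H →L[ℂ] H) (x : H) {n : ℕ}
    (f : ⨂[ℂ]^n H) (g : ⨂[ℂ]^(n + 1) H) :
    inner00 (n + 1) (create x n f) (symmetrization α q J (n + 1) g) =
      inner00 n f (symmetrization α q J n (opr q x n g + (α : ℂ) • opl q J x n g)) := by
  induction g using PiTensorProduct.induction_on with
  | smul_tprod r y =>
    simp only [map_smul, smul_comm (α : ℂ) r, ← smul_add]
    congr 1
    have h1 : (1 : ℤˣ) ≠ -1 := by decide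
    have h2 : (-1 : ℤˣ) ≠ 1 := by decide
    have hL : inner00 (n + 1) (create x n f)
        (symmetrization α q J (n + 1) (PiTensorProduct.tprod ℂ y)) =
        ∑ k : Fin (n + 1), ∑ s : ℤˣ, ∑ w : SignedPerm n,
          ((α : ℂ) ^ (w.l₁ + if s = -1 then 1 else 0) *
            (q : ℂ) ^ (w.l₂ + if s = -1 then n + k else n - k)) *
          (⟪x, signMap J s (y k)⟫_ℂ * inner00 n f (PiTensorProduct.tprod ℂ
            (fun i => signMap J (w.2 i) (y (k.succAbove (w.1 i)))))) := by
      rw [← Fintype.sum_prod_type', ← Fintype.sum_prod_type']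
      simp only [symmetrization, LinearMap.sum_apply, map_sum, LinearMap.smul_apply, map_smul,
        act_tprod, inner00_create, smul_eq_mul]
      rw [← (SignedPerm.extend_bijective n).sum_comp]
      refine Finset.sum_congr rfl fun t _ => ?_
      simp only [SignedPerm.l₁_extend, SignedPerm.l₂_extend, SignedPerm.extend_sign_last,
        SignedPerm.extend_sign_castSucc]
      have e1 := SignedPerm.extend_last t.1.1 t.1.2 t.2
      have e2 := SignedPerm.extend_castSucc t.1.1 t.1.2 t.2
      congr 2
      · exact congrArg (fun j => ⟪x, signMap J t.1.2 (y j)⟫_ℂ) e1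
      · refine congrArg (fun z => inner00 n f (PiTensorProduct.tprod ℂ z)) (funext fun i => ?_)
        exact congrArg (fun j => signMap J (t.2.2 i) (y j)) (e2 i)
    rw [hL]
    have hU : ∀ F : ℤˣ → ℂ, ∑ s : ℤˣ, F s = F 1 + F (-1) := by
      intro F
      have : (Finset.univ : Finset ℤˣ) = {1, -1} := by decide
      rw [this, Finset.sum_pair h1]
    simp only [hU, if_neg h1, if_true, add_zero, signMap, if_neg h2]
    simp only [opr, opl, LinearMap.sum_apply, LinearMap.smul_apply, contract_tprod, map_add,
      map_sum, map_smul, symmetrization, act_tprod, smul_eq_mul, LinearMap.comp_apply,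
      Finset.mul_sum, Finset.sum_add_distrib]
    congr 1
    · refine Finset.sum_congr rfl fun k _ => Finset.sum_congr rfl fun w _ => ?_
      simp [signMap, pow_add]
      ring
    · refine Finset.sum_congr rfl fun k _ => Finset.sum_congr rfl fun w _ => ?_
      simp [signMap, pow_add]
      ring
  | add a b ha hb =>
    simp only [map_add, smul_add] at *
    rw [ha, hb]; ring

theorem annihilation_apply (α q : ℝ) (J : H →L[ℂ] H) (x : H) (g : Fock H) (n : ℕ) :
    annihilation α q J x g n = opr q x n (g (n + 1)) + (α : ℂ) • opl q J x n (g (n + 1)) := by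
  induction g using DirectSum.induction_on with
  | zero => simp
  | of m a =>
    rw [annihilation, ← DirectSum.lof_eq_of ℂ, DirectSum.toModule_lof]
    match m with
    | 0 => simp [DirectSum.lof_eq_of, DirectSum.of_eq_of_ne]
    | m + 1 =>
      by_cases h : m = n
      · subst h; simp [DirectSum.lof_eq_of]
      · have h' : m + 1 ≠ n + 1 := by omega
        simp [DirectSum.lof_eq_of, DirectSum.of_eq_of_ne, Ne.symm h]
  | add a b ha hb =>
    simp only [map_add, DirectSum.add_apply, ha, hb, smul_add]; abel

/-- `⟨b*(x) f, g⟩_{α,q} = ⟨f, b(x) g⟩_{α,q}`. -/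
theorem fockInner_creation_left (α q : ℝ) (J : H →L[ℂ] H) (x : H) (f g : Fock H) :
    fockInner α q J (creation x f) g = fockInner α q J f (annihilation α q J x g) := by
  induction f using DirectSum.induction_on with
  | zero => simp [fockInner]
  | of m a =>
    rw [creation, ← DirectSum.lof_eq_of ℂ, DirectSum.toModule_lof, LinearMap.comp_apply,
      fockInner_incl, inner00_create_symmetrization]
    rw [show DirectSum.lof ℂ ℕ (fun n => ⨂[ℂ]^n H) m a = incl m a from rfl, fockInner_incl,
      annihilation_apply]
  | add a b ha hb =>
    simp only [fockInner, map_add] at *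
    rw [ha, hb]

end Fock

/-! ### Set partitions, type B partitions and their statistics -/

section Partitions

/-- Set partitions of `[n]`. -/
abbrev SetPartition (n : ℕ) : Type := Finpartition (Finset.univ : Finset (Fin n))

/-- The arcs `(i, j)` of `π`: `i < j` lie in the same block and no element of this block lies
strictly between them. -/
def arcs {n : ℕ} (π : SetPartition n) : Finset (Fin n × Fin n) :=
  Finset.univ.filter fun a =>
    a.1 < a.2 ∧ ∃ B ∈ π.parts, a.1 ∈ B ∧ a.2 ∈ B ∧ ∀ k ∈ B, ¬ (a.1 < k ∧ k < a.2)

/-- The arc `V` nests the arc `W`. -/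
def Nests {n : ℕ} (V W : Fin n × Fin n) : Prop :=
  V.1 < W.1 ∧ W.2 < V.2

/-- The number of restricted crossings: every crossing pair of arcs, `i < i' < j < j'`, is counted
once. -/
def rc {n : ℕ} (π : SetPartition n) : ℕ :=
  ((arcs π ×ˢ arcs π).filter fun p =>
    p.1.1 < p.2.1 ∧ p.2.1 < p.1.2 ∧ p.1.2 < p.2.2).card

/-- The number of outer arcs: the arcs which are not nested by another arc. -/
def outArc {n : ℕ} (π : SetPartition n) : ℕ :=
  open Classical in ((arcs π).filter fun W => ∀ V ∈ arcs π, ¬ Nests V W).card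

/-- Noncrossing partitions: there are no `a < b < c < d` with `a, c` in one block and `b, d` in
another block. -/
def IsNoncrossing {n : ℕ} (π : SetPartition n) : Prop :=
  ∀ B ∈ π.parts, ∀ C ∈ π.parts, B ≠ C → ∀ a b c d : Fin n,
    a < b → b < c → c < d → a ∈ B → c ∈ B → b ∈ C → d ∉ C

/-- The set partitions of `[n]` without singletons. -/
def partitionsGeTwo (n : ℕ) : Finset (SetPartition n) :=
  Finset.univ.filter fun π => ∀ B ∈ π.parts, 2 ≤ B.card

/-- The noncrossing partitions of `[n]` without singletons. -/
def noncrossingGeTwo (n : ℕ) : Finset (SetPartition n) :=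
  open Classical in (partitionsGeTwo n).filter IsNoncrossing

/-- Type B set partitions of `[n]`: a set partition and a colouring of its arcs by `±1`. (All
singletons have colour `1`.) -/
abbrev TypeBPartition (n : ℕ) : Type :=
  Σ π : SetPartition n, ({a // a ∈ arcs π} → ℤˣ)

/-- The type B pair partitions of `[n]`: every block has two elements. -/
def typeBPairPartitions (n : ℕ) : Finset (TypeBPartition n) :=
  Finset.univ.filter fun p => ∀ B ∈ p.1.parts, B.card = 2

/-- The number of negative arcs. -/
def narc {n : ℕ} (p : TypeBPartition n) : ℕ :=
  (Finset.univ.filter fun W => p.2 W = -1).card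

/-- The number of restricted negative nestings: the pairs `(V, W)` of arcs such that `V` nests `W`
and `W` is negative. -/
def rnarc {n : ℕ} (p : TypeBPartition n) : ℕ :=
  open Classical in
  (Finset.univ.filter fun t : {a // a ∈ arcs p.1} × {a // a ∈ arcs p.1} =>
    Nests t.1.1 t.2.1 ∧ p.2 t.2 = -1).card

end Partitions

/-- For a block `B = {i₁ < ⋯ < i_m}` the number
`⟨x_{i_m}, T_{i_{m-1}} ⋯ T_{i₂} x_{i₁}⟩`, where `T_i` is the operator attached to `i`. -/
def blockCumulant {H : Type*} [NormedAddCommGroup H] [InnerProductSpace ℂ H] {n : ℕ}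
    (T : Fin n → H →L[ℂ] H) (x : Fin n → H) (B : Finset (Fin n)) (hB : B.Nonempty) : ℂ :=
  ⟪x (B.max' hB),
    (((B.erase (B.min' hB)).erase (B.max' hB)).sort (· ≤ ·)).foldl (fun v i => T i v)
      (x (B.min' hB))⟫_ℂ

/-- `∏_{B ∈ π} ⟨x_{max B}, ∏_{i ∈ B, i ≠ min B, max B} T_i x_{min B}⟩`. -/
def partitionCumulant {H : Type*} [NormedAddCommGroup H] [InnerProductSpace ℂ H] {n : ℕ}
    (T : Fin n → H →L[ℂ] H) (x : Fin n → H) (π : SetPartition n) : ℂ :=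
  ∏ B : {B // B ∈ π.parts}, blockCumulant T x B.1 (π.nonempty_of_mem_parts B.2)

/-- The joint moment `φ_{α,q}(B^λ_{α,q}(x_n) ⋯ B^λ_{α,q}(x_1))` of type B operators, for
`x₁, …, xₙ` in the real space and a family `T_x` of operators indexed by it. -/
def moment {HR H : Type*} [NormedAddCommGroup HR] [InnerProductSpace ℝ HR]
    [NormedAddCommGroup H] [InnerProductSpace ℂ H] (ι : HR →ₗ[ℝ] H) (J : H →L[ℂ] H)
    (T : HR → H →L[ℂ] H) (α q lam : ℝ) {n : ℕ} (x : Fin n → HR) : ℂ :=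
  vacuumState α q J
    ((List.ofFn fun i => typeBOperator α q J lam (T (x i)) (ι (x i))).reverse.prod)

end TypeB

end

noncomputable section

namespace TypeB

open Finset

/-! Apply the operators to the vacuum one after another. At time `n` the vector is a combination of
simple tensors, and every tensor factor belongs to a block that is not yet finished, labelled by its
latest point (an "open" point). Creation appends a factor at the right end, which starts a block.
The gauge term removes a factor and puts its image at the right end, which continues a block.
Annihilation removes a factor, which finishes a block. New factors always go to the right end, so
the factors stay sorted by their labels, and the set of labels recovers all positions.

Continuing or finishing the block of the open point `i` at time `n` draws the arc `(i, n)`. If `k`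
open points lie to the left of `i` and `m - k` to the right, the two terms of the formulas have
weights `q ^ (m - k)` and `α q ^ (m + k) = α q ^ ((m - k) + 2 k)`. The choice of term is a sign on
the arc. In a diagram that is finally closed, the remaining open points are the starts of arcs
ending after `n`: those to the right of `i` give crossings with `(i, n)`, those to the left give
arcs nesting it. Multiplying over all arcs gives `α ^ narc * q ^ (rc + 2 * rnarc)`, and each block
contributes an inner product built along its arcs. Pairing with the vacuum keeps the diagrams
without open points, which are the coloured partitions without singletons.

`Diagram.stateVector_eq` carries out this expansion, `sum_diagrams_eq` replaces closed diagrams by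
coloured partitions, `weight_code` identifies the weights, and `moment_eq_sum` is the resulting
formula for all `α` and `q`. The three cases are specialisations. For `α = 0` only the all-positive
colouring survives. For `T = 0` blocks with three or more points vanish. For `q = 0` crossings
vanish, the block factors do not depend on the colouring, and the sum over colourings factors over
the arcs: an outer arc gives `1 + α`, a nested one gives `1`. -/

/-- The weight of an arc with sign `s` starting at `i`, where `L` is the set of starting points of
the other arcs which are open when the arc is closed. -/
def arcWeight (α q : ℂ) (L : Finset ℕ) (i : ℕ) (s : ℤˣ) : ℂ :=
  if s = 1 then q ^ #{k ∈ L | i < k} else α * q ^ (#{k ∈ L | i < k} + 2 * #{k ∈ L | k < i})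

theorem sum_signs {M : Type*} [AddCommMonoid M] (F : ℤˣ → M) : ∑ s, F s = F 1 + F (-1) := by
  have : (univ : Finset ℤˣ) = {1, -1} := by decide
  rw [this, sum_pair (by decide)]

theorem strictMono_snoc {m n : ℕ} {e : Fin m → ℕ} (he : StrictMono e) (hn : ∀ k, e k < n) :
    StrictMono (Fin.snoc e n : Fin (m + 1) → ℕ) := by
  intro a b hab
  induction b using Fin.lastCases with
  | last =>
    induction a using Fin.lastCases with
    | last => exact absurd hab (lt_irrefl _)
    | cast a => simpa using hn a
  | cast b =>
    induction a using Fin.lastCases with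
    | last => exact absurd hab (not_lt.2 (Fin.le_last _))
    | cast a => simpa using he (Fin.castSucc_lt_castSucc_iff.1 hab)

/-- The Fock space operators depend on the position of a factor, the diagram statistics on the
labels; this lemma and the next translate one into the other. -/
theorem card_filter_lt_orderEmbOfFin (O : Finset ℕ) {m : ℕ} (h : #O = m + 1) (k : Fin (m + 1)) :
    #{j ∈ O.erase (O.orderEmbOfFin h k) | j < O.orderEmbOfFin h k} = k := by
  have : {j ∈ O.erase (O.orderEmbOfFin h k) | j < O.orderEmbOfFin h k} =
      (Finset.Iio k).map (O.orderEmbOfFin h).toEmbedding := by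
    ext j
    simp only [mem_filter, mem_erase, mem_map, mem_Iio]
    constructor
    · rintro ⟨⟨_, hj⟩, hlt⟩
      rw [← mem_coe, ← range_orderEmbOfFin O h] at hj
      obtain ⟨l, rfl⟩ := hj
      exact ⟨l, (O.orderEmbOfFin h).lt_iff_lt.1 hlt, rfl⟩
    · rintro ⟨l, hl, rfl⟩
      have := (O.orderEmbOfFin h).lt_iff_lt.2 hl
      exact ⟨⟨this.ne, orderEmbOfFin_mem _ _ _⟩, this⟩
  rw [this, card_map, Fin.card_Iio]

theorem card_filter_gt_orderEmbOfFin (O : Finset ℕ) {m : ℕ} (h : #O = m + 1) (k : Fin (m + 1)) :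
    #{j ∈ O.erase (O.orderEmbOfFin h k) | O.orderEmbOfFin h k < j} = m - k := by
  have : {j ∈ O.erase (O.orderEmbOfFin h k) | O.orderEmbOfFin h k < j} =
      (Finset.Ioi k).map (O.orderEmbOfFin h).toEmbedding := by
    ext j
    simp only [mem_filter, mem_erase, mem_map, mem_Ioi]
    constructor
    · rintro ⟨⟨_, hj⟩, hlt⟩
      rw [← mem_coe, ← range_orderEmbOfFin O h] at hj
      obtain ⟨l, rfl⟩ := hj
      exact ⟨l, (O.orderEmbOfFin h).lt_iff_lt.1 hlt, rfl⟩
    · rintro ⟨l, hl, rfl⟩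
      have := (O.orderEmbOfFin h).lt_iff_lt.2 hl
      exact ⟨⟨this.ne', orderEmbOfFin_mem _ _ _⟩, this⟩
  rw [this, card_map, Fin.card_Ioi]
  omega

theorem sum_orderEmbOfFin {M : Type*} [AddCommMonoid M] (O : Finset ℕ) {m : ℕ} (h : #O = m)
    (F : ℕ → M) : ∑ i ∈ O, F i = ∑ k, F (O.orderEmbOfFin h k) := by
  conv_lhs => rw [← map_orderEmbOfFin_univ O h, sum_map]
  rfl

/-! ### The operators on simple tensors labelled by finite sets -/

section Fock

variable {H : Type*} [NormedAddCommGroup H] [InnerProductSpace ℂ H]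

/-- The simple tensor of the vectors `v i`, `i ∈ O`, in increasing order of `i`. -/
def orderedTensor (O : Finset ℕ) (v : ℕ → H) : Fock H :=
  incl #O (PiTensorProduct.tprod ℂ fun k => v (O.orderEmbOfFin rfl k))

/-- A finite set has only one increasing enumeration. Any such enumeration may therefore be used in
place of the canonical one, and the degree `m` need not be literally `#O`. -/
theorem incl_tprod_eq (O : Finset ℕ) (v : ℕ → H) {m : ℕ} (h : #O = m) {e : Fin m → ℕ}
    (he : StrictMono e) (hO : ∀ k, e k ∈ O) (y : Fin m → H) (hy : ∀ k, y k = v (e k)) :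
    incl m (PiTensorProduct.tprod ℂ y) = orderedTensor O v := by
  subst h
  rw [orderedTensor]
  congr 2
  funext k
  rw [hy, orderEmbOfFin_unique rfl hO he]

theorem orderedTensor_congr {O : Finset ℕ} {v w : ℕ → H} (h : ∀ i ∈ O, v i = w i) :
    orderedTensor O v = orderedTensor O w := by
  rw [orderedTensor, orderedTensor]
  congr 2
  funext k
  exact h _ (orderEmbOfFin_mem _ _ _)

theorem orderedTensor_empty (v : ℕ → H) : orderedTensor ∅ v = vacuum H :=
  (incl_tprod_eq ∅ v card_empty (e := fun i : Fin 0 => i.elim0) (fun i => i.elim0)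
    (fun i => i.elim0) _ fun i => i.elim0).symm

/-- Since `n` exceeds every label in `O`, appending on the right is the same as inserting the label
`n`. -/
theorem creation_orderedTensor (x : H) (O : Finset ℕ) (v : ℕ → H) (n : ℕ) (hn : ∀ i ∈ O, i < n)
    (w : ℕ → H) (hw : ∀ i ∈ O, w i = v i) (hx : w n = x) :
    creation x (orderedTensor O v) = orderedTensor (insert n O) w := by
  have hnO : n ∉ O := fun h => lt_irrefl _ (hn n h)
  rw [orderedTensor, creation, DirectSum.toModule_lof, LinearMap.comp_apply, create_tprod]
  refine incl_tprod_eq _ _ (card_insert_of_notMem hnO)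
    (strictMono_snoc (O.orderEmbOfFin rfl).strictMono fun k => hn _ (orderEmbOfFin_mem _ _ _))
    (fun k => ?_) _ fun k => ?_
  · induction k using Fin.lastCases with
    | last => simp
    | cast k => simp
  · induction k using Fin.lastCases with
    | last => simp [hx]
    | cast k => simp [hw]

theorem incl_tprod_erase (O : Finset ℕ) (v : ℕ → H) {m : ℕ} (h : #O = m + 1) (k : Fin (m + 1)) :
    incl m (PiTensorProduct.tprod ℂ fun i => v (O.orderEmbOfFin h (k.succAbove i))) =
      orderedTensor (O.erase (O.orderEmbOfFin h k)) v := by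
  refine incl_tprod_eq _ _ ?_ (e := fun i => O.orderEmbOfFin h (k.succAbove i))
    ((O.orderEmbOfFin h).strictMono.comp (Fin.strictMono_succAbove k)) (fun i => ?_) _ fun i => rfl
  · rw [card_erase_of_mem (orderEmbOfFin_mem _ _ _), h, Nat.add_sub_cancel]
  · rw [mem_erase]
    exact ⟨fun hh => Fin.succAbove_ne k i ((O.orderEmbOfFin h).injective hh),
      orderEmbOfFin_mem _ _ _⟩

theorem incl_tprod_erase_snoc (O : Finset ℕ) (v : ℕ → H) {m : ℕ} (h : #O = m + 1) (k : Fin (m + 1))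
    (n : ℕ) (hn : ∀ i ∈ O, i < n) (w : ℕ → H) (hw : ∀ i ∈ O, w i = v i) :
    incl (m + 1) (PiTensorProduct.tprod ℂ
      (Fin.snoc (fun i => v (O.orderEmbOfFin h (k.succAbove i))) (w n) : Fin (m + 1) → H)) =
      orderedTensor (insert n (O.erase (O.orderEmbOfFin h k))) w := by
  have := creation_orderedTensor (w n) (O.erase (O.orderEmbOfFin h k)) v n
    (fun i hi => hn i (mem_of_mem_erase hi)) w (fun i hi => hw i (mem_of_mem_erase hi)) rfl
  rw [← this, ← incl_tprod_erase, creation, DirectSum.toModule_lof, LinearMap.comp_apply,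
    create_tprod]

theorem annihilation_orderedTensor (α q : ℝ) (J : H →L[ℂ] H) (x : H) (O : Finset ℕ) (v : ℕ → H) :
    annihilation α q J x (orderedTensor O v) =
      ∑ i ∈ O, ∑ s : ℤˣ, (arcWeight α q (O.erase i) i s * ⟪x, signMap J s (v i)⟫_ℂ) •
        orderedTensor (O.erase i) v := by
  obtain hm | ⟨m, hm⟩ : #O = 0 ∨ ∃ m, #O = m + 1 := by
    cases h : #O with
    | zero => exact .inl rfl
    | succ m => exact .inr ⟨m, rfl⟩
  · rw [card_eq_zero] at hm
    subst hm
    rw [sum_empty, orderedTensor_empty, vacuum, annihilation, DirectSum.toModule_lof]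
    rfl
  · rw [← incl_tprod_eq O v hm (O.orderEmbOfFin hm).strictMono (orderEmbOfFin_mem _ _) _
      fun k => rfl, annihilation, DirectSum.toModule_lof, sum_orderEmbOfFin O hm]
    have h2 : (-1 : ℤˣ) ≠ 1 := by decide
    simp only [LinearMap.comp_apply, opr, opl, LinearMap.add_apply, LinearMap.sum_apply,
      LinearMap.smul_apply, contract_tprod, map_add, map_sum, map_smul, incl_tprod_erase,
      sum_signs, arcWeight, card_filter_gt_orderEmbOfFin, card_filter_lt_orderEmbOfFin,
      if_true, if_neg h2, signMap, sum_add_distrib, smul_sum, smul_smul]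
    congr 1
    refine sum_congr rfl fun k _ => ?_
    congr 1
    -- There are `m - k` labels to the right of the removed one and `k` to the left, so the exponent
    -- `m + k` of the second term counts the right ones once and the left ones twice, as `arcWeight`
    -- does.
    have : m - (k : ℕ) + 2 * k = m + k := by omega
    rw [this, pow_add]
    simp

/-- The removed factor returns at the right end under the new label `n`. Its vector depends on the
point `i` and on the sign `s`, hence one labelling `w i s` for each term. -/
theorem gaugeOperator_orderedTensor (α q : ℝ) (J A : H →L[ℂ] H) (O : Finset ℕ) (v : ℕ → H)
    (n : ℕ) (hn : ∀ i ∈ O, i < n) (w : ℕ → ℤˣ → ℕ → H) (hw : ∀ i s, ∀ k ∈ O, w i s k = v k)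
    (hwn : ∀ i s, w i s n = A (signMap J s (v i))) :
    gaugeOperator α q J A (orderedTensor O v) =
      ∑ i ∈ O, ∑ s : ℤˣ, arcWeight α q (O.erase i) i s •
        orderedTensor (insert n (O.erase i)) (w i s) := by
  obtain hm | ⟨m, hm⟩ : #O = 0 ∨ ∃ m, #O = m + 1 := by
    cases h : #O with
    | zero => exact .inl rfl
    | succ m => exact .inr ⟨m, rfl⟩
  · rw [card_eq_zero] at hm
    subst hm
    rw [sum_empty, orderedTensor_empty, vacuum, gaugeOperator, DirectSum.toModule_lof]
    rfl
  · rw [← incl_tprod_eq O v hm (O.orderEmbOfFin hm).strictMono (orderEmbOfFin_mem _ _) _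
      fun k => rfl, gaugeOperator, DirectSum.toModule_lof, sum_orderEmbOfFin O hm]
    have h2 : (-1 : ℤˣ) ≠ 1 := by decide
    have hs : ∀ (k : Fin (m + 1)) (s : ℤˣ), orderedTensor
        (insert n (O.erase (O.orderEmbOfFin hm k))) (w (O.orderEmbOfFin hm k) s) =
        incl (m + 1) (PiTensorProduct.tprod ℂ
          (Fin.snoc (fun i => v (O.orderEmbOfFin hm (k.succAbove i)))
            (A (signMap J s (v (O.orderEmbOfFin hm k)))) : Fin (m + 1) → H)) := fun k s => by
      rw [← incl_tprod_erase_snoc O v hm k n hn _ (hw _ s), hwn]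
    simp only [hs, LinearMap.comp_apply, opR, LinearMap.add_apply, LinearMap.sum_apply,
      LinearMap.smul_apply, toLast_tprod, onLast_tprod, map_add, map_sum, map_smul,
      sum_signs, arcWeight, card_filter_gt_orderEmbOfFin, card_filter_lt_orderEmbOfFin,
      if_true, if_neg h2, signMap, sum_add_distrib, smul_sum, smul_smul]
    congr 1
    refine sum_congr rfl fun k _ => ?_
    congr 1
    have : m - (k : ℕ) + 2 * k = m + k := by omega
    rw [this, pow_add]
    ring

theorem fockInner_add_right (α q : ℝ) (J : H →L[ℂ] H) (f g : Fock H) :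
    fockInner α q J (vacuum H) (f + g) =
      fockInner α q J (vacuum H) f + fockInner α q J (vacuum H) g := by
  simp only [vacuum, fockInner_incl, DirectSum.add_apply, map_add]

/-- The functional `g ↦ ⟨Ω, g⟩_{α,q}`. -/
def vacuumFunctional (α q : ℝ) (J : H →L[ℂ] H) : Fock H →ₗ[ℂ] ℂ where
  toFun g := fockInner α q J (vacuum H) g
  map_add' f g := fockInner_add_right α q J f g
  map_smul' c g := by
    simp only [vacuum, fockInner_incl, DirectSum.smul_apply, map_smul, RingHom.id_apply]

/-- Different degrees are orthogonal, and in degree zero the symmetrization is the identity. -/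
theorem vacuumFunctional_orderedTensor (α q : ℝ) (J : H →L[ℂ] H) (O : Finset ℕ) (v : ℕ → H) :
    vacuumFunctional α q J (orderedTensor O v) = if O = ∅ then 1 else 0 := by
  change fockInner α q J (vacuum H) _ = _
  rw [vacuum, fockInner_incl]
  split_ifs with h
  · subst h
    rw [orderedTensor_empty, vacuum, incl, DirectSum.lof_apply]
    simp [symmetrization, act_tprod, inner00_tprod, SignedPerm.l₁, SignedPerm.l₂]
  · have : orderedTensor O v 0 = 0 := by
      rw [orderedTensor, incl, DirectSum.lof_eq_of, DirectSum.of_eq_of_ne]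
      exact (card_ne_zero_of_mem (nonempty_iff_ne_empty.2 h).choose_spec).symm
    rw [this, map_zero, map_zero]

end Fock

/-! ### Arc diagrams built point by point -/

/-- A partially built coloured arc diagram: the first component sends `j` to `(i, s)` if `(i, j)` is
an arc of sign `s`, the second is the set of the points at which an arc is still to start. -/
abbrev Diagram : Type := (ℕ → Option (ℕ × ℤˣ)) × Finset ℕ

namespace Diagram

/-- The ways to add a point to a diagram with open points `O`: start a new block, or add the point
to the block of an open point `i`, by an arc of sign `s`, as an open point or not. -/
def options (O : Finset ℕ) : Finset (Option (ℕ × ℤˣ × Bool)) := insertNone (O ×ˢ univ)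

/-- The diagram obtained by adding the point `n`. -/
def step (n : ℕ) (c : Diagram) : Option (ℕ × ℤˣ × Bool) → Diagram
  | none => (c.1, insert n c.2)
  | some (i, s, true) => (Function.update c.1 n (some (i, s)), insert n (c.2.erase i))
  | some (i, s, false) => (Function.update c.1 n (some (i, s)), c.2.erase i)

open Classical in
/-- The diagrams on `{0, …, n - 1}`. -/
def diagrams : ℕ → Finset Diagram
  | 0 => {(fun _ => none, ∅)}
  | n + 1 => ((diagrams n).sigma fun c => options c.2).image fun t => step n t.1 t.2

/-- The conditions which describe `diagrams n`. -/
structure Valid (n : ℕ) (c : Diagram) : Prop where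
  lt : ∀ {j i s}, c.1 j = some (i, s) → i < j ∧ j < n
  inj : ∀ {j j' i s s'}, c.1 j = some (i, s) → c.1 j' = some (i, s') → j = j'
  lt_of_mem : ∀ {i}, i ∈ c.2 → i < n
  ne_of_mem : ∀ {i}, i ∈ c.2 → ∀ j s, c.1 j ≠ some (i, s)
  exists_of_notMem : ∀ {j}, j < n → j ∉ c.2 → c.1 j = none → ∃ k s, c.1 k = some (j, s)

theorem mem_options_some {O : Finset ℕ} {i : ℕ} {s : ℤˣ} {b : Bool} :
    some (i, s, b) ∈ options O ↔ i ∈ O := by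
  simp [options]

theorem none_mem_options {O : Finset ℕ} : none ∈ options O := by
  simp [options]

theorem Valid.eq_none {n : ℕ} {c : Diagram} (h : Valid n c) {j : ℕ} (hj : n ≤ j) :
    c.1 j = none := by
  cases hc : c.1 j with
  | none => rfl
  | some t => exact absurd (h.lt (i := t.1) (s := t.2) hc).2 (not_lt.2 hj)

theorem Valid.step {n : ℕ} {c : Diagram} (h : Valid n c) {o : Option (ℕ × ℤˣ × Bool)}
    (ho : o ∈ options c.2) : Valid (n + 1) (step n c o) := by
  obtain ⟨h1, h2, h3, h4, h5⟩ := id h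
  have h6 : c.1 n = none := h.eq_none le_rfl
  match o with
  | none =>
    constructor <;> simp only [Diagram.step] <;> grind
  | some (i, s, true) =>
    rw [mem_options_some] at ho
    rw [Diagram.step]
    generalize hp : Function.update c.1 n (some (i, s)) = p'
    have e1 : p' n = some (i, s) := by rw [← hp, Function.update_self]
    have e2 : ∀ k, k ≠ n → p' k = c.1 k := fun k hk => by rw [← hp, Function.update_of_ne hk]
    constructor <;> dsimp only <;> grind
  | some (i, s, false) =>
    rw [mem_options_some] at ho
    rw [Diagram.step]
    generalize hp : Function.update c.1 n (some (i, s)) = p'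
    have e1 : p' n = some (i, s) := by rw [← hp, Function.update_self]
    have e2 : ∀ k, k ≠ n → p' k = c.1 k := fun k hk => by rw [← hp, Function.update_of_ne hk]
    constructor <;> dsimp only <;> grind

/-- Remove the last point `n`. If no arc ends there, `n` must be open, because no arc can start at
the last point; it was then added as a new block. If an arc `(i, n)` ends there, its start `i` is
made open again. -/
theorem Valid.exists_step {n : ℕ} {c : Diagram} (h : Valid (n + 1) c) :
    ∃ d o, Valid n d ∧ o ∈ options d.2 ∧ Diagram.step n d o = c := by
  obtain ⟨h1, h2, h3, h4, h5⟩ := id h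
  have h6 : ∀ k s, c.1 k ≠ some (n, s) := fun k s hk => by
    have := h1 hk
    omega
  obtain ⟨p, O⟩ := c
  cases hn : p n with
  | none =>
    have hO : n ∈ O := by
      by_contra hO
      obtain ⟨k, s, hk⟩ := h5 (Nat.lt_succ_self n) hO hn
      exact h6 k s hk
    refine ⟨(p, O.erase n), none, ?_, none_mem_options, ?_⟩
    · constructor <;> grind
    · simp only [Diagram.step, insert_erase hO]
  | some t =>
    obtain ⟨i, s⟩ := t
    have hi : i ∉ O := fun hi => h4 hi n s hn
    have hin : i < n := (h1 hn).1
    have hp : Function.update (Function.update p n none) n (some (i, s)) = p := by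
      rw [Function.update_idem, ← hn, Function.update_eq_self]
    by_cases hO : n ∈ O
    · refine ⟨(Function.update p n none, insert i (O.erase n)), some (i, s, true), ?_,
        by simp [mem_options_some], ?_⟩
      · constructor <;> simp only [Function.update_apply] <;> grind
      · have : i ∉ O.erase n := fun hh => hi (mem_of_mem_erase hh)
        simp only [Diagram.step, hp, erase_insert this, insert_erase hO]
    · refine ⟨(Function.update p n none, insert i O), some (i, s, false), ?_,
        by simp [mem_options_some], ?_⟩
      · constructor <;> simp only [Function.update_apply] <;> grind
      · simp only [Diagram.step, hp, erase_insert hi]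

/-- A step can be undone. The value at `n` gives the point and the sign that were chosen, membership
of `n` in the open set tells whether the block was continued, and erasing this information restores
the earlier diagram. -/
theorem step_injective {n : ℕ} {c d : Diagram} (hc : Valid n c) (hd : Valid n d)
    {o o' : Option (ℕ × ℤˣ × Bool)} (ho : o ∈ options c.2) (ho' : o' ∈ options d.2)
    (h : step n c o = step n d o') : c = d ∧ o = o' := by
  have key : ∀ {c : Diagram} {o : Option (ℕ × ℤˣ × Bool)}, Valid n c → o ∈ options c.2 →
      c.1 = Function.update (step n c o).1 n none ∧
      o = ((step n c o).1 n).map (fun t => (t.1, t.2, decide (n ∈ (step n c o).2))) ∧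
      c.2 = ((step n c o).1 n).elim ((step n c o).2.erase n)
        (fun t => insert t.1 ((step n c o).2.erase n)) := by
    intro c o hc ho
    have h1 : c.1 n = none := hc.eq_none le_rfl
    have h2 : n ∉ c.2 := fun h => lt_irrefl _ (hc.lt_of_mem h)
    have h3 : Function.update c.1 n none = c.1 := by rw [← h1, Function.update_eq_self]
    match o with
    | none => simp [step, h1, h2, h3]
    | some (i, s, true) =>
      rw [mem_options_some] at ho
      simp [step, h2, h3, insert_erase ho]
    | some (i, s, false) =>
      rw [mem_options_some] at ho
      simp [step, h2, h3, insert_erase ho]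
  obtain ⟨a1, a2, a3⟩ := key hc ho
  obtain ⟨b1, b2, b3⟩ := key hd ho'
  rw [h] at a1 a2 a3
  exact ⟨Prod.ext (a1.trans b1.symm) (a3.trans b3.symm), a2.trans b2.symm⟩

/-- The recursive description matches the Fock space recursion, the description by conditions
matches set partitions; both are needed. -/
theorem mem_diagrams {n : ℕ} {c : Diagram} : c ∈ diagrams n ↔ Valid n c := by
  induction n generalizing c with
  | zero =>
    rw [diagrams, mem_singleton]
    constructor
    · rintro rfl
      constructor <;> simp
    · intro h
      refine Prod.ext (funext fun j => h.eq_none (Nat.zero_le j)) ?_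
      exact eq_empty_of_forall_notMem fun i hi => Nat.not_lt_zero _ (h.lt_of_mem hi)
  | succ n ih =>
    simp only [diagrams, mem_image, mem_sigma, Sigma.exists, ih]
    constructor
    · rintro ⟨d, o, ⟨hd, ho⟩, rfl⟩
      exact hd.step ho
    · intro h
      obtain ⟨d, o, hd, ho, hs⟩ := h.exists_step
      exact ⟨d, o, ⟨hd, ho⟩, hs⟩

open Classical in
-- By injectivity of the steps no diagram is counted twice. The three kinds of terms correspond to
-- creation, gauge and annihilation.
theorem sum_diagrams_succ {M : Type*} [AddCommMonoid M] (n : ℕ) (F : Diagram → M) :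
    ∑ c ∈ diagrams (n + 1), F c = ∑ c ∈ diagrams n, (F (step n c none) +
      ∑ i ∈ c.2, ∑ s, (F (step n c (some (i, s, true))) + F (step n c (some (i, s, false))))) := by
  rw [diagrams, sum_image, sum_sigma]
  · refine sum_congr rfl fun c _ => ?_
    rw [options, sum_insertNone, sum_product]
    simp only [Fintype.sum_prod_type, Fintype.sum_bool]
  · rintro ⟨c, o⟩ hc ⟨d, o'⟩ hd h
    simp only [coe_sigma, Set.mem_sigma_iff, mem_coe, mem_diagrams] at hc hd
    obtain ⟨h1, h2⟩ := step_injective hc.1 hd.1 hc.2 hd.2 h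
    rw [h1, h2]

open Classical in
/-- The points below `j` at which an arc starts that ends above `j`. -/
def live (c : Diagram) (j : ℕ) : Finset ℕ :=
  {i ∈ range j | i ∈ c.2 ∨ ∃ k s, j < k ∧ c.1 k = some (i, s)}

/-- No arc starts at `j`. -/
def IsTerminal (c : Diagram) (j : ℕ) : Prop := j ∉ c.2 ∧ ∀ k s, c.1 k ≠ some (j, s)

/-- Adding `n` may turn an open point into the start of an arc ending at `n`. For a point below `j`
with `j < n`, either status counts as live at `j`. The new open point `n` is not below `j`. -/
theorem live_step {n : ℕ} {c : Diagram} (hc : Valid n c) {o : Option (ℕ × ℤˣ × Bool)}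
    (ho : o ∈ options c.2) {j : ℕ} (hj : j < n) : live (step n c o) j = live c j := by
  have h1 : c.1 n = none := hc.eq_none le_rfl
  ext i
  simp only [live, mem_filter, mem_range]
  match o with
  | none => simp only [step]; grind
  | some (i, s, true) =>
    rw [mem_options_some] at ho
    rw [Diagram.step]
    generalize hp : Function.update c.1 n (some (i, s)) = p'
    have e1 : p' n = some (i, s) := by rw [← hp, Function.update_self]
    have e2 : ∀ k, k ≠ n → p' k = c.1 k := fun k hk => by rw [← hp, Function.update_of_ne hk]
    grind
  | some (i, s, false) =>
    rw [mem_options_some] at ho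
    rw [Diagram.step]
    generalize hp : Function.update c.1 n (some (i, s)) = p'
    have e1 : p' n = some (i, s) := by rw [← hp, Function.update_self]
    have e2 : ∀ k, k ≠ n → p' k = c.1 k := fun k hk => by rw [← hp, Function.update_of_ne hk]
    grind

theorem isTerminal_step {n : ℕ} {c : Diagram} (hc : Valid n c) {o : Option (ℕ × ℤˣ × Bool)}
    (ho : o ∈ options c.2) {j : ℕ} (hj : j < n) :
    IsTerminal (step n c o) j ↔ IsTerminal c j := by
  have h1 : c.1 n = none := hc.eq_none le_rfl
  simp only [IsTerminal]
  match o with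
  | none => simp only [step]; grind
  | some (i, s, true) =>
    rw [mem_options_some] at ho
    rw [Diagram.step]
    generalize hp : Function.update c.1 n (some (i, s)) = p'
    have e1 : p' n = some (i, s) := by rw [← hp, Function.update_self]
    have e2 : ∀ k, k ≠ n → p' k = c.1 k := fun k hk => by rw [← hp, Function.update_of_ne hk]
    grind
  | some (i, s, false) =>
    rw [mem_options_some] at ho
    rw [Diagram.step]
    generalize hp : Function.update c.1 n (some (i, s)) = p'
    have e1 : p' n = some (i, s) := by rw [← hp, Function.update_self]
    have e2 : ∀ k, k ≠ n → p' k = c.1 k := fun k hk => by rw [← hp, Function.update_of_ne hk]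
    grind

/-- No arc ends after `n` yet, so the live points are the open points below `n`; the chosen `i` has
just been used. -/
theorem live_step_self {n : ℕ} {c : Diagram} (hc : Valid n c) {i : ℕ} {s : ℤˣ} {b : Bool} :
    live (step n c (some (i, s, b))) n = c.2.erase i := by
  have h2 : ∀ {k}, k ∈ c.2 → k < n := hc.lt_of_mem
  have h3 : ∀ k, n < k → c.1 k = none := fun k hk => hc.eq_none hk.le
  ext k
  simp only [live, mem_filter, mem_range, mem_erase]
  cases b <;> simp only [step, Function.update_apply] <;> grind

/-! ### Weights of diagrams and the expansion of the state vector -/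

section Fock

variable {H : Type*} [NormedAddCommGroup H] [InnerProductSpace ℂ H]
  (α q : ℝ) (J : H →L[ℂ] H) (A : ℕ → H →L[ℂ] H) (X : ℕ → H)

/-- The vector obtained from the part of the block of `j` up to `j`. -/
def vec (p : ℕ → Option (ℕ × ℤˣ)) (j : ℕ) : H :=
  match p j with
  | none => X j
  | some (i, s) => if i < j then A j (signMap J s (vec p i)) else 0
termination_by j

variable {J A X} in
theorem vec_none {p : ℕ → Option (ℕ × ℤˣ)} {j : ℕ} (h : p j = none) : vec J A X p j = X j := by
  rw [vec, h]

variable {J A X} in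
theorem vec_some {p : ℕ → Option (ℕ × ℤˣ)} {i j : ℕ} {s : ℤˣ} (h : p j = some (i, s))
    (hij : i < j) : vec J A X p j = A j (signMap J s (vec J A X p i)) := by
  rw [vec, h]
  simp only [if_pos hij]

theorem vec_congr {p p' : ℕ → Option (ℕ × ℤˣ)} {j : ℕ} (h : ∀ k ≤ j, p k = p' k) :
    vec J A X p j = vec J A X p' j := by
  induction j using Nat.strong_induction_on with
  | _ j ih =>
    rw [vec, vec, h j le_rfl]
    cases hj : p' j with
    | none => rfl
    | some t =>
      dsimp only
      split_ifs with hlt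
      · rw [ih _ hlt fun k hk => h k (hk.trans hlt.le)]
      · rfl

open Classical in
/-- The contribution of the arc which ends at `j`. -/
def factor (c : Diagram) (j : ℕ) : ℂ :=
  match c.1 j with
  | none => 1
  | some (i, s) => arcWeight α q (live c j) i s *
      if IsTerminal c j then ⟪X j, signMap J s (vec J A X c.1 i)⟫_ℂ else 1

/-- The coefficient of a diagram. -/
def weight (n : ℕ) (c : Diagram) : ℂ := ∏ j ∈ range n, factor α q J A X c j

theorem step_fst_of_lt {n : ℕ} (c : Diagram) (o : Option (ℕ × ℤˣ × Bool)) {j : ℕ} (hj : j < n) :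
    (step n c o).1 j = c.1 j := by
  match o with
  | none => rfl
  | some (i, s, true) => exact Function.update_of_ne hj.ne _ _
  | some (i, s, false) => exact Function.update_of_ne hj.ne _ _

theorem vec_step {n : ℕ} (c : Diagram) (o : Option (ℕ × ℤˣ × Bool)) {j : ℕ} (hj : j < n) :
    vec J A X (step n c o).1 j = vec J A X c.1 j :=
  vec_congr J A X fun _ hk => step_fst_of_lt c o (hk.trans_lt hj)

/-- The factor at `j` is already determined when `j` is added: its live set, its terminal status and
the vectors below it are unaffected by later points. This makes the weight multiplicative along the
recursion. -/
theorem factor_step {n : ℕ} {c : Diagram} (hc : Valid n c) {o : Option (ℕ × ℤˣ × Bool)}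
    (ho : o ∈ options c.2) {j : ℕ} (hj : j < n) :
    factor α q J A X (step n c o) j = factor α q J A X c j := by
  simp only [factor, step_fst_of_lt c o hj, live_step hc ho hj]
  cases h : c.1 j with
  | none => rfl
  | some t =>
    have := (hc.lt (i := t.1) (s := t.2) h).1
    simp only [vec_step J A X c o (this.trans hj)]
    classical exact congrArg _ (if_congr (isTerminal_step hc ho hj) rfl rfl)

theorem weight_step {n : ℕ} {c : Diagram} (hc : Valid n c) {o : Option (ℕ × ℤˣ × Bool)}
    (ho : o ∈ options c.2) : weight α q J A X (n + 1) (step n c o) =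
      weight α q J A X n c * factor α q J A X (step n c o) n := by
  rw [weight, prod_range_succ, weight]
  congr 1
  exact prod_congr rfl fun j hj => factor_step α q J A X hc ho (mem_range.1 hj)

theorem factor_step_none {n : ℕ} {c : Diagram} (hc : Valid n c) :
    factor α q J A X (step n c none) n = 1 := by
  have h1 : (step n c none).1 n = none := hc.eq_none le_rfl
  rw [factor, h1]

theorem factor_step_true {n : ℕ} {c : Diagram} (hc : Valid n c) {i : ℕ} {s : ℤˣ} :
    factor α q J A X (step n c (some (i, s, true))) n = arcWeight α q (c.2.erase i) i s := by
  have h1 : (step n c (some (i, s, true))).1 n = some (i, s) := Function.update_self _ _ _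
  have h2 : ¬ IsTerminal (step n c (some (i, s, true))) n := fun h =>
    h.1 (mem_insert_self _ _)
  rw [factor, h1]
  simp only [live_step_self hc, if_neg h2, mul_one]

theorem factor_step_false {n : ℕ} {c : Diagram} (hc : Valid n c) {i : ℕ} {s : ℤˣ} (hi : i ∈ c.2) :
    factor α q J A X (step n c (some (i, s, false))) n =
      arcWeight α q (c.2.erase i) i s * ⟪X n, signMap J s (vec J A X c.1 i)⟫_ℂ := by
  have h1 : (step n c (some (i, s, false))).1 n = some (i, s) := Function.update_self _ _ _
  have h2 : IsTerminal (step n c (some (i, s, false))) n := by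
    refine ⟨fun h => lt_irrefl _ (hc.lt_of_mem (mem_of_mem_erase h)), fun k s' h => ?_⟩
    have := (hc.step (mem_options_some.2 hi)).lt h
    omega
  rw [factor, h1]
  simp only [live_step_self hc, if_pos h2, vec_step J A X c _ (hc.lt_of_mem hi)]

/-- The vector `B(X_{n-1}) ⋯ B(X_0) Ω`. -/
def stateVector : ℕ → Fock H
  | 0 => vacuum H
  | n + 1 => typeBOperator α q J 0 (A n) (X n) (stateVector n)

/-- Creation gives the option `none`, the gauge operator the options with `true`, and annihilation
those with `false`. This is the one-step form of the expansion. -/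
theorem typeBOperator_orderedTensor {n : ℕ} {c : Diagram} (hc : Valid n c) :
    typeBOperator α q J 0 (A n) (X n) (orderedTensor c.2 (vec J A X c.1)) =
      orderedTensor (step n c none).2 (vec J A X (step n c none).1) +
      ∑ i ∈ c.2, ∑ s,
        (factor α q J A X (step n c (some (i, s, true))) n •
          orderedTensor (step n c (some (i, s, true))).2
            (vec J A X (step n c (some (i, s, true))).1) +
        factor α q J A X (step n c (some (i, s, false))) n •
          orderedTensor (step n c (some (i, s, false))).2
            (vec J A X (step n c (some (i, s, false))).1)) := by
  simp only [typeBOperator, LinearMap.add_apply, Complex.ofReal_zero, zero_smul, add_zero]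
  rw [creation_orderedTensor (X n) c.2 _ n (fun i => hc.lt_of_mem)
      (vec J A X (step n c none).1) (fun i hi => vec_step J A X c none (hc.lt_of_mem hi))
      (vec_none (hc.eq_none le_rfl)), annihilation_orderedTensor,
    gaugeOperator_orderedTensor α q J (A n) c.2 _ n (fun i => hc.lt_of_mem)
      -- The labelling has to take the prescribed value at `n` for every `i`, whereas `vec` is only
      -- meaningful along arcs with `i < n`. The second branch is a filler; open points satisfy `i <
      -- n`.
      (fun i s => if i < n then vec J A X (step n c (some (i, s, true))).1 else
        Function.update (vec J A X c.1) n (A n (signMap J s (vec J A X c.1 i))))]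
  · rw [add_comm (∑ i ∈ c.2, _), add_assoc, add_comm (∑ i ∈ c.2, _), ← sum_add_distrib]
    congr 1
    refine sum_congr rfl fun i hi => ?_
    rw [← sum_add_distrib]
    refine sum_congr rfl fun s _ => ?_
    rw [factor_step_true α q J A X hc, factor_step_false α q J A X hc hi,
      if_pos (hc.lt_of_mem hi)]
    congr 2
    exact orderedTensor_congr fun k hk =>
      (vec_step J A X c _ (hc.lt_of_mem (mem_of_mem_erase hk))).symm
  · intro i s k hk
    split_ifs
    · exact vec_step J A X c _ (hc.lt_of_mem hk)
    · exact Function.update_of_ne (hc.lt_of_mem hk).ne _ _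
  · intro i s
    split_ifs with hi
    · have h1 : (step n c (some (i, s, true))).1 n = some (i, s) := Function.update_self _ _ _
      rw [vec_some h1 hi, vec_step J A X c _ hi]
    · exact Function.update_self _ _ _

theorem stateVector_eq (n : ℕ) : stateVector α q J A X n =
    ∑ c ∈ diagrams n, weight α q J A X n c • orderedTensor c.2 (vec J A X c.1) := by
  induction n with
  | zero => simp [stateVector, diagrams, weight, orderedTensor_empty]
  | succ n ih =>
    rw [stateVector, ih, sum_diagrams_succ, map_sum]
    refine sum_congr rfl fun c hc => ?_
    rw [mem_diagrams] at hc
    rw [map_smul, typeBOperator_orderedTensor α q J A X hc,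
      weight_step α q J A X hc none_mem_options, factor_step_none α q J A X hc, mul_one, smul_add,
      smul_sum]
    congr 1
    refine sum_congr rfl fun i hi => ?_
    rw [smul_sum]
    refine sum_congr rfl fun s _ => ?_
    rw [weight_step α q J A X hc (mem_options_some.2 hi),
      weight_step α q J A X hc (mem_options_some.2 hi), smul_add, smul_smul, smul_smul]

theorem vacuumFunctional_stateVector (n : ℕ) :
    vacuumFunctional α q J (stateVector α q J A X n) =
      ∑ c ∈ diagrams n with c.2 = ∅, weight α q J A X n c := by
  rw [stateVector_eq, map_sum, sum_filter]
  refine sum_congr rfl fun c _ => ?_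
  rw [map_smul, vacuumFunctional_orderedTensor, smul_eq_mul, mul_ite, mul_one, mul_zero]

end Fock

end Diagram

/-- The product is reversed, so the operator of the first point acts first. `A` and `X` extend the
two families to all natural numbers; their values from `n` on play no role here. -/
theorem moment_eq_stateVector {HR H : Type*} [NormedAddCommGroup HR] [InnerProductSpace ℝ HR]
    [NormedAddCommGroup H] [InnerProductSpace ℂ H] (ι : HR →ₗ[ℝ] H) (J : H →L[ℂ] H)
    (T : HR → H →L[ℂ] H) (α q : ℝ) {n : ℕ} (x : Fin n → HR) (A : ℕ → H →L[ℂ] H) (X : ℕ → H)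
    (hA : ∀ i : Fin n, A i = T (x i)) (hX : ∀ i : Fin n, X i = ι (x i)) :
    moment ι J T α q 0 x = vacuumFunctional α q J (Diagram.stateVector α q J A X n) := by
  rw [moment, vacuumState]
  change _ = fockInner α q J (vacuum H) _
  congr 1
  induction n with
  | zero => rfl
  | succ n ih =>
    rw [List.ofFn_succ', List.concat_eq_append, List.reverse_append, List.reverse_singleton,
      List.singleton_append, List.prod_cons, Module.End.mul_apply,
      ih (fun i => x i.castSucc) (fun i => hA i.castSucc) (fun i => hX i.castSucc),
      Diagram.stateVector, ← hA, ← hX]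
    rfl

/-! ### Arcs of a set partition -/

section Arcs

variable {n : ℕ} {π : SetPartition n}

theorem mem_part_univ (π : SetPartition n) (i : Fin n) : i ∈ π.part i :=
  π.mem_part (mem_univ i)

theorem part_eq_iff_mem {i j : Fin n} : π.part i = π.part j ↔ i ∈ π.part j := by
  constructor
  · intro h
    rw [← h]
    exact mem_part_univ π i
  · intro h
    exact π.part_eq_of_mem (π.part_mem.2 (mem_univ j)) h

theorem mem_arcs_iff {a : Fin n × Fin n} : a ∈ arcs π ↔
    a.1 < a.2 ∧ π.part a.1 = π.part a.2 ∧
      ∀ k, π.part k = π.part a.2 → ¬ (a.1 < k ∧ k < a.2) := by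
  simp only [arcs, mem_filter, mem_univ, true_and, part_eq_iff_mem]
  refine and_congr_right fun _ => ?_
  constructor
  · rintro ⟨B, hB, h1, h2, h3⟩
    rw [π.part_eq_of_mem hB h2]
    exact ⟨h1, h3⟩
  · rintro ⟨h1, h2⟩
    exact ⟨π.part a.2, π.part_mem.2 (mem_univ _), h1, mem_part_univ π _, h2⟩

theorem arcs_left_unique {a b : Fin n × Fin n} (ha : a ∈ arcs π) (hb : b ∈ arcs π)
    (h : a.2 = b.2) : a = b := by
  rw [mem_arcs_iff] at ha hb
  refine Prod.ext ?_ h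
  rcases lt_trichotomy a.1 b.1 with h1 | h1 | h1
  · exact absurd ⟨h1, h ▸ hb.1⟩ (ha.2.2 b.1 (h ▸ hb.2.1))
  · exact h1
  · exact absurd ⟨h1, h ▸ ha.1⟩ (hb.2.2 a.1 (h ▸ ha.2.1))

theorem arcs_right_unique {a b : Fin n × Fin n} (ha : a ∈ arcs π) (hb : b ∈ arcs π)
    (h : a.1 = b.1) : a = b := by
  rw [mem_arcs_iff] at ha hb
  have hp : π.part a.2 = π.part b.2 := by rw [← ha.2.1, ← hb.2.1, h]
  refine Prod.ext h ?_
  rcases lt_trichotomy a.2 b.2 with h1 | h1 | h1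
  · exact absurd ⟨h ▸ ha.1, h1⟩ (hb.2.2 a.2 hp)
  · exact h1
  · exact absurd ⟨h ▸ hb.1, h1⟩ (ha.2.2 b.2 hp.symm)

theorem exists_arc_to {a b : Fin n} (hab : a < b) (h : π.part a = π.part b) :
    ∃ i, (i, b) ∈ arcs π ∧ a ≤ i := by
  have hne : ({k | k < b ∧ π.part k = π.part b} : Finset (Fin n)).Nonempty := ⟨a, by simp [hab, h]⟩
  have hm := max'_mem _ hne
  simp only [mem_filter, mem_univ, true_and] at hm
  refine ⟨_, mem_arcs_iff.2 ⟨hm.1, hm.2, fun k hk hlt => ?_⟩, le_max' _ _ (by simp [hab, h])⟩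
  exact absurd hlt.1 (not_lt.2 (le_max' _ _ (by simp [hlt.2, hk])))

theorem exists_arc_from {a b : Fin n} (hab : a < b) (h : π.part a = π.part b) :
    ∃ j, (a, j) ∈ arcs π ∧ j ≤ b := by
  have hne : ({k | a < k ∧ π.part k = π.part b} : Finset (Fin n)).Nonempty := ⟨b, by simp [hab]⟩
  have hm := min'_mem _ hne
  simp only [mem_filter, mem_univ, true_and] at hm
  refine ⟨_, mem_arcs_iff.2 ⟨hm.1, h.trans hm.2.symm, fun k hk hlt => ?_⟩,
    min'_le _ _ (by simp [hab])⟩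
  exact absurd hlt.2 (not_lt.2 (min'_le _ _ (by simp [hlt.1, hk.trans hm.2])))

/-- Descend from `b` to its predecessor in the block, and so on, until `a` is reached; every arc
used on the way is also an arc of `π'`. -/
theorem part_eq_of_arcs_subset {π' : SetPartition n} (h : arcs π ⊆ arcs π') {a b : Fin n}
    (hab : a < b) (hp : π.part a = π.part b) : π'.part a = π'.part b := by
  induction b using WellFoundedLT.induction with
  | _ b ih =>
    obtain ⟨i, hi, hai⟩ := exists_arc_to hab hp
    have h1 := mem_arcs_iff.1 hi
    have h2 := mem_arcs_iff.1 (h hi)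
    rcases hai.eq_or_lt with rfl | hlt
    · exact h2.2.1
    · exact (ih i h1.1 hlt (hp.trans h1.2.1.symm)).trans h2.2.1

theorem eq_of_part_eq_iff {π' : SetPartition n}
    (h : ∀ a b, π.part a = π.part b ↔ π'.part a = π'.part b) : π = π' := by
  have hp : ∀ a, π.part a = π'.part a := fun a => by
    ext b
    rw [← part_eq_iff_mem, h, part_eq_iff_mem]
  refine Finpartition.ext ?_
  ext B
  constructor
  · intro hB
    obtain ⟨a, ha⟩ := π.nonempty_of_mem_parts hB
    rw [← π.part_eq_of_mem hB ha, hp]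
    exact π'.part_mem.2 (mem_univ a)
  · intro hB
    obtain ⟨a, ha⟩ := π'.nonempty_of_mem_parts hB
    rw [← π'.part_eq_of_mem hB ha, ← hp]
    exact π.part_mem.2 (mem_univ a)

/-- The blocks are the equivalence classes generated by the arcs. -/
theorem arcs_injective {π' : SetPartition n} (h : arcs π = arcs π') : π = π' := by
  refine eq_of_part_eq_iff fun a b => ?_
  rcases lt_trichotomy a b with hab | rfl | hab
  · exact ⟨part_eq_of_arcs_subset h.subset hab, part_eq_of_arcs_subset h.symm.subset hab⟩
  · simp
  · exact ⟨fun hp => (part_eq_of_arcs_subset h.subset hab hp.symm).symm,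
      fun hp => (part_eq_of_arcs_subset h.symm.subset hab hp.symm).symm⟩

end Arcs

/-! ### Coloured partitions without singletons as closed diagrams -/

section Code

variable {n : ℕ}

open Classical in
/-- The function which sends `j` to `(i, s)` if `(i, j)` is an arc of sign `s`. -/
def code (P : TypeBPartition n) (j : ℕ) : Option (ℕ × ℤˣ) :=
  if h : ∃ a : {a // a ∈ arcs P.1}, (a.1.2 : ℕ) = j then
    some ((h.choose.1.1 : ℕ), P.2 h.choose) else none

theorem code_eq_some {P : TypeBPartition n} {j i : ℕ} {s : ℤˣ} :
    code P j = some (i, s) ↔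
      ∃ a : {a // a ∈ arcs P.1}, (a.1.1 : ℕ) = i ∧ (a.1.2 : ℕ) = j ∧ P.2 a = s := by
  rw [code]
  split_ifs with h
  · simp only [Option.some.injEq, Prod.mk.injEq]
    constructor
    · rintro ⟨h1, h2⟩
      exact ⟨h.choose, h1, h.choose_spec, h2⟩
    · rintro ⟨a, h1, h2, h3⟩
      have : h.choose = a := Subtype.ext (arcs_left_unique h.choose.2 a.2
        (Fin.ext (h.choose_spec.trans h2.symm)))
      rw [this]
      exact ⟨h1, h3⟩
  · simp only [false_iff]
    rintro ⟨a, _, h2, _⟩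
    exact h ⟨a, h2⟩

theorem code_arc (P : TypeBPartition n) (a : {a // a ∈ arcs P.1}) :
    code P a.1.2 = some ((a.1.1 : ℕ), P.2 a) :=
  code_eq_some.2 ⟨a, rfl, rfl, rfl⟩

theorem mem_arcs_iff_code {P : TypeBPartition n} {a : Fin n × Fin n} :
    a ∈ arcs P.1 ↔ ∃ s, code P a.2 = some ((a.1 : ℕ), s) := by
  constructor
  · intro h
    exact ⟨_, code_arc P ⟨a, h⟩⟩
  · rintro ⟨s, hs⟩
    obtain ⟨b, h1, h2, _⟩ := code_eq_some.1 hs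
    have : b.1 = a := Prod.ext (Fin.ext h1) (Fin.ext h2)
    exact this ▸ b.2

theorem code_injective : Function.Injective (code (n := n)) := by
  rintro ⟨π, f⟩ ⟨π', f'⟩ h
  have hπ : π = π' := arcs_injective (by
    ext a
    rw [mem_arcs_iff_code (P := ⟨π, f⟩), mem_arcs_iff_code (P := ⟨π', f'⟩), h])
  subst hπ
  congr 1
  funext a
  have h1 := code_arc ⟨π, f⟩ a
  rw [h, code_arc ⟨π, f'⟩ a] at h1
  simpa using h1.symm

/-- The absence of singletons enters in the last condition: a point at which no arc ends has another
point in its block, necessarily a larger one, so an arc starts there. -/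
theorem valid_code {P : TypeBPartition n} (hP : P.1 ∈ partitionsGeTwo n) :
    Diagram.Valid n (code P, ∅) where
  lt := by
    intro j i s h
    obtain ⟨a, rfl, rfl, _⟩ := code_eq_some.1 h
    exact ⟨(mem_arcs_iff.1 a.2).1, a.1.2.2⟩
  inj := by
    intro j j' i s s' h h'
    obtain ⟨a, rfl, rfl, _⟩ := code_eq_some.1 h
    obtain ⟨b, h1, rfl, _⟩ := code_eq_some.1 h'
    rw [arcs_right_unique a.2 b.2 (Fin.ext h1.symm)]
  lt_of_mem := by simp
  ne_of_mem := by simp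
  exists_of_notMem := by
    intro j hj _ h
    have hB := (mem_filter.1 hP).2 _ (P.1.part_mem.2 (mem_univ ⟨j, hj⟩))
    obtain ⟨k, hk, hkj⟩ := exists_mem_ne (show 1 < #(P.1.part ⟨j, hj⟩) from hB) ⟨j, hj⟩
    rw [← part_eq_iff_mem] at hk
    rcases lt_or_gt_of_ne hkj with hlt | hlt
    · obtain ⟨i, hi, _⟩ := exists_arc_to hlt hk
      have := code_arc P ⟨_, hi⟩
      rw [show code P _ = none from h] at this
      cases this
    · obtain ⟨l, hl, _⟩ := exists_arc_from hlt hk.symm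
      exact ⟨_, _, code_arc P ⟨_, hl⟩⟩

/-- `(i, j)` is an arc. -/
def IsArc (c : Diagram) (i j : ℕ) : Prop := ∃ s, c.1 j = some (i, s)

variable {c : Diagram}

theorem le_of_reflTransGen (hc : Diagram.Valid n c) {a b : ℕ}
    (h : Relation.ReflTransGen (IsArc c) a b) : a ≤ b := by
  induction h with
  | refl => exact le_rfl
  | tail _ h ih =>
    obtain ⟨s, hs⟩ := h
    exact ih.trans (hc.lt hs).1.le

theorem isArc_rightUnique (hc : Diagram.Valid n c) : Relator.RightUnique (IsArc c) := by
  rintro a b b' ⟨s, h⟩ ⟨s', h'⟩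
  exact hc.inj h h'

theorem isArc_leftUnique {a b d : ℕ} (h : IsArc c a d) (h' : IsArc c b d) : a = b := by
  obtain ⟨s, h⟩ := h
  obtain ⟨s', h'⟩ := h'
  rw [h] at h'
  simp only [Option.some.injEq, Prod.mk.injEq] at h'
  exact h'.1

/-- Each point is the end of at most one arc, so following arcs backwards from `d` is deterministic
and one of `a`, `b` is met before the other (or they coincide). -/
theorem reflTransGen_total_left {a b d : ℕ} (h : Relation.ReflTransGen (IsArc c) a d)
    (h' : Relation.ReflTransGen (IsArc c) b d) :
    Relation.ReflTransGen (IsArc c) a b ∨ Relation.ReflTransGen (IsArc c) b a := by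
  have := Relation.ReflTransGen.total_of_right_unique
    (r := Function.swap (IsArc c)) (fun _ _ _ h h' => isArc_leftUnique h h')
    (Relation.reflTransGen_swap.2 h) (Relation.reflTransGen_swap.2 h')
  exact this.symm.imp Relation.reflTransGen_swap.1 Relation.reflTransGen_swap.1

/-- The points of a diagram are equivalent if they are joined by a path of arcs. -/
def blockSetoid (hc : Diagram.Valid n c) : Setoid (Fin n) where
  r a b := Relation.ReflTransGen (IsArc c) a b ∨ Relation.ReflTransGen (IsArc c) b a
  iseqv :=
    { refl := fun _ => .inl .refl
      symm := Or.symm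
      trans := by
        rintro a b d (h | h) (h' | h')
        · exact .inl (h.trans h')
        · exact reflTransGen_total_left h h'
        · exact Relation.ReflTransGen.total_of_right_unique (isArc_rightUnique hc) h h'
        · exact .inr (h'.trans h) }

open Classical in
/-- The set partition whose arcs are those of a diagram. -/
def blockPartition (hc : Diagram.Valid n c) : SetPartition n :=
  Finpartition.ofSetoid (blockSetoid hc)

theorem blockPartition_part_eq_iff (hc : Diagram.Valid n c) {a b : Fin n} :
    (blockPartition hc).part a = (blockPartition hc).part b ↔
      Relation.ReflTransGen (IsArc c) a b ∨ Relation.ReflTransGen (IsArc c) b a := by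
  classical
  rw [part_eq_iff_mem, blockPartition, Finpartition.mem_part_ofSetoid_iff_rel]
  exact or_comm

/-- The last arc `(k, j)` of a path from `i` to `j` starts at `i`, for otherwise `k` would be a
point of the block strictly between. Conversely, any path reaching `j` from below passes through the
unique predecessor of `j`, so nothing in the block lies between them. -/
theorem mem_arcs_blockPartition (hc : Diagram.Valid n c) {a : Fin n × Fin n} :
    a ∈ arcs (blockPartition hc) ↔ IsArc c a.1 a.2 := by
  have key : ∀ {i j : ℕ}, i < j → (Relation.ReflTransGen (IsArc c) i j ∨
      Relation.ReflTransGen (IsArc c) j i) → ∃ k, Relation.ReflTransGen (IsArc c) i k ∧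
        IsArc c k j := by
    rintro i j hij (h | h)
    · rcases h.cases_tail with h | h
      · exact absurd h hij.ne'
      · exact h
    · exact absurd hij (not_lt.2 (le_of_reflTransGen hc h))
  simp only [mem_arcs_iff, blockPartition_part_eq_iff]
  constructor
  · rintro ⟨hlt, h1, h2⟩
    obtain ⟨k, hk, s, hs⟩ := key hlt h1
    have hkj := (hc.lt hs).1
    rcases (le_of_reflTransGen hc hk).eq_or_lt with hik | hik
    · rw [hik]
      exact ⟨s, hs⟩
    · exact absurd ⟨hik, hkj⟩ (h2 ⟨k, hkj.trans a.2.2⟩ (.inl (.single ⟨s, hs⟩)))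
  · rintro ⟨s, hs⟩
    refine ⟨(hc.lt hs).1, .inl (.single ⟨s, hs⟩), fun k hk hlt => ?_⟩
    obtain ⟨l, hl, hla⟩ := key (Fin.lt_def.1 hlt.2) hk
    rw [isArc_leftUnique hla ⟨s, hs⟩] at hl
    exact absurd hlt.1 (not_lt.2 (le_of_reflTransGen hc hl))

theorem exists_code_eq (hc : Diagram.Valid n c) (h0 : c.2 = ∅) :
    ∃ P : TypeBPartition n, P.1 ∈ partitionsGeTwo n ∧ code P = c.1 := by
  -- The default colour `1` is never read, because the diagram assigns a value to the right end of
  -- every arc.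
  refine ⟨⟨blockPartition hc, fun a => (c.1 a.1.2).elim 1 Prod.snd⟩, ?_, ?_⟩
  · simp only [partitionsGeTwo, mem_filter, mem_univ, true_and]
    intro B hB
    obtain ⟨a, ha⟩ := (blockPartition hc).nonempty_of_mem_parts hB
    obtain rfl := (blockPartition hc).part_eq_of_mem hB ha
    refine one_lt_card.2 ⟨a, ha, ?_⟩
    simp only [← part_eq_iff_mem, blockPartition_part_eq_iff]
    cases h : c.1 a with
    | none =>
      obtain ⟨k, s, hk⟩ := hc.exists_of_notMem a.2 (h0 ▸ notMem_empty _) h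
      have := hc.lt hk
      exact ⟨⟨k, this.2⟩, .inr (.single ⟨s, hk⟩), fun h => this.1.ne (congrArg Fin.val h)⟩
    | some t =>
      have := (hc.lt (i := t.1) (s := t.2) h).1
      exact ⟨⟨t.1, this.trans a.2⟩, .inl (.single ⟨t.2, h⟩),
        fun h => this.ne' (congrArg Fin.val h)⟩
  · funext j
    refine Option.ext fun ⟨i, s⟩ => ?_
    rw [code_eq_some]
    constructor
    · rintro ⟨⟨a, ha⟩, rfl, rfl, h⟩
      obtain ⟨s', hs'⟩ := (mem_arcs_blockPartition hc).1 ha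
      simp only [hs', Option.elim] at h
      rw [hs', h]
    · intro h
      have := hc.lt h
      exact ⟨⟨(⟨i, this.1.trans this.2⟩, ⟨j, this.2⟩),
        (mem_arcs_blockPartition hc).2 ⟨s, h⟩⟩, rfl, rfl, by simp [h]⟩

theorem sum_diagrams_eq {M : Type*} [AddCommMonoid M] (W : Diagram → M) :
    ∑ c ∈ Diagram.diagrams n with c.2 = ∅, W c =
      ∑ P ∈ (partitionsGeTwo n).sigma fun _ => univ, W (code P, ∅) := by
  symm
  refine sum_bij (fun P _ => (code P, ∅)) ?_ ?_ ?_ fun _ _ => rfl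
  · intro P hP
    rw [mem_filter, Diagram.mem_diagrams]
    exact ⟨valid_code (mem_sigma.1 hP).1, rfl⟩
  · intro P _ P' _ h
    exact code_injective (congrArg Prod.fst h)
  · intro d hd
    rw [mem_filter, Diagram.mem_diagrams] at hd
    obtain ⟨P, hP, h⟩ := exists_code_eq hd.1 hd.2
    exact ⟨P, mem_sigma.2 ⟨hP, mem_univ _⟩, Prod.ext h hd.2.symm⟩

end Code

/-! ### Crossings, nestings and the general moment formula -/

section Statistics

variable {n : ℕ} (P : TypeBPartition n)

/-- The number of arcs which cross the arc `a` and end to the right of it. -/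
def crossingNumber (π : SetPartition n) (a : Fin n × Fin n) : ℕ :=
  #{b ∈ arcs π | a.1 < b.1 ∧ b.1 < a.2 ∧ a.2 < b.2}

open Classical in
/-- The number of arcs which nest the arc `a`. -/
def nestingNumber (π : SetPartition n) (a : Fin n × Fin n) : ℕ :=
  #{b ∈ arcs π | Nests b a}

/-- Each crossing is charged to the arc that ends first, which is the arc whose weight records it.
-/
theorem rc_eq_sum (π : SetPartition n) :
    rc π = ∑ a : {a // a ∈ arcs π}, crossingNumber π a.1 := by
  rw [rc, card_filter, sum_product, sum_coe_sort (arcs π) (crossingNumber π)]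
  exact sum_congr rfl fun a _ => (card_filter _ _).symm

theorem rnarc_eq_sum :
    rnarc P = ∑ a, if P.2 a = 1 then 0 else nestingNumber P.1 a.1 := by
  classical
  rw [rnarc, card_filter, Fintype.sum_prod_type_right]
  refine sum_congr rfl fun a _ => ?_
  rw [nestingNumber, card_filter, ← sum_coe_sort (arcs P.1)]
  rcases Int.units_eq_one_or (P.2 a) with h | h <;> simp [h]

theorem narc_eq_sum : narc P = ∑ a, if P.2 a = 1 then 0 else 1 := by
  rw [narc, card_filter]
  refine sum_congr rfl fun a _ => ?_
  rcases Int.units_eq_one_or (P.2 a) with h | h <;> simp [h]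

theorem mem_live_code {a : Fin n × Fin n} {i : ℕ} :
    i ∈ Diagram.live (code P, ∅) a.2 ↔ ∃ b ∈ arcs P.1, (b.1 : ℕ) = i ∧ b.1 < a.2 ∧ a.2 < b.2 := by
  simp only [Diagram.live, mem_filter, mem_range, notMem_empty, false_or, code_eq_some]
  constructor
  · rintro ⟨h, k, s, hk, b, rfl, rfl, _⟩
    exact ⟨b.1, b.2, rfl, h, hk⟩
  · rintro ⟨b, hb, rfl, h1, h2⟩
    exact ⟨h1, b.2, _, h2, ⟨b, hb⟩, rfl, rfl, rfl⟩

/-- An arc is determined by its starting point, so counting live points counts arcs. -/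
theorem card_live_gt (a : Fin n × Fin n) :
    #{k ∈ Diagram.live (code P, ∅) a.2 | (a.1 : ℕ) < k} = crossingNumber P.1 a := by
  symm
  refine card_bij (fun b _ => (b.1 : ℕ)) ?_ ?_ ?_
  · intro b hb
    rw [mem_filter] at hb
    rw [mem_filter, mem_live_code]
    exact ⟨⟨b, hb.1, rfl, hb.2.2⟩, hb.2.1⟩
  · intro b hb b' hb' h
    exact arcs_right_unique (mem_filter.1 hb).1 (mem_filter.1 hb').1 (Fin.ext h)
  · intro k hk
    rw [mem_filter, mem_live_code] at hk
    obtain ⟨⟨b, hb, rfl, h⟩, hlt⟩ := hk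
    exact ⟨b, mem_filter.2 ⟨hb, hlt, h⟩, rfl⟩

/-- The arcs live at the right end of `a` that start to the left of `a` are those enclosing it; the
count again goes through starting points. -/
theorem card_live_lt {a : Fin n × Fin n} (ha : a ∈ arcs P.1) :
    #{k ∈ Diagram.live (code P, ∅) a.2 | k < (a.1 : ℕ)} = nestingNumber P.1 a := by
  classical
  symm
  refine card_bij (fun b _ => (b.1 : ℕ)) ?_ ?_ ?_
  · intro b hb
    rw [mem_filter] at hb
    rw [mem_filter, mem_live_code]
    exact ⟨⟨b, hb.1, rfl, hb.2.1.trans (mem_arcs_iff.1 ha).1, hb.2.2⟩, hb.2.1⟩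
  · intro b hb b' hb' h
    exact arcs_right_unique (mem_filter.1 hb).1 (mem_filter.1 hb').1 (Fin.ext h)
  · intro k hk
    rw [mem_filter, mem_live_code] at hk
    obtain ⟨⟨b, hb, rfl, h⟩, hlt⟩ := hk
    exact ⟨b, mem_filter.2 ⟨hb, hlt, h.2⟩, rfl⟩

theorem prod_arcWeight (α q : ℂ) :
    ∏ a : {a // a ∈ arcs P.1},
        arcWeight α q (Diagram.live (code P, ∅) a.1.2) a.1.1 (P.2 a) =
      α ^ narc P * q ^ (rc P.1 + 2 * rnarc P) := by
  rw [narc_eq_sum, rc_eq_sum, rnarc_eq_sum, mul_sum, ← sum_add_distrib, ← prod_pow_eq_pow_sum,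
    ← prod_pow_eq_pow_sum, ← prod_mul_distrib]
  refine prod_congr rfl fun a _ => ?_
  rw [arcWeight, card_live_gt, card_live_lt P a.2]
  split_ifs <;> simp

variable {H : Type*} [NormedAddCommGroup H] [InnerProductSpace ℂ H]
  (α q : ℝ) (J : H →L[ℂ] H) (A : ℕ → H →L[ℂ] H) (X : ℕ → H)

open Classical in
/-- The product over the blocks `i₁ < ⋯ < i_m` of the inner product of `X i_m` with the vector
obtained by following the arcs of the block. -/
def signedCumulant : ℂ :=
  ∏ a : {a // a ∈ arcs P.1}, if Diagram.IsTerminal (code P, ∅) a.1.2 then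
    ⟪X a.1.2, signMap J (P.2 a) (Diagram.vec J A X (code P) a.1.1)⟫_ℂ else 1

/-- Points at which no arc ends have factor `1`, so the product over points is a product over arcs,
indexed by right ends. -/
theorem weight_code :
    Diagram.weight α q J A X n (code P, ∅) =
      (α : ℂ) ^ narc P * (q : ℂ) ^ (rc P.1 + 2 * rnarc P) * signedCumulant P J A X := by
  classical
  rw [← prod_arcWeight, signedCumulant, ← prod_mul_distrib, Diagram.weight]
  symm
  refine prod_of_injOn (fun a => (a.1.2 : ℕ)) ?_ ?_ ?_ ?_
  · intro a _ b _ h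
    exact Subtype.ext (arcs_left_unique a.2 b.2 (Fin.ext h))
  · intro a _
    exact mem_coe.2 (mem_range.2 a.1.2.2)
  · intro j _ hj
    have : code P j = none := by
      cases h : code P j with
      | none => rfl
      | some t =>
        obtain ⟨a, _, h2, _⟩ := code_eq_some.1 (show code P j = some (t.1, t.2) from h)
        exact absurd ⟨a, mem_coe.2 (mem_univ a), h2⟩ hj
    simp only [Diagram.factor, this]
  · intro a _
    simp only [Diagram.factor, code_arc]

/-- The joint moments for arbitrary parameters. -/
theorem moment_eq_sum {HR : Type*} [NormedAddCommGroup HR] [InnerProductSpace ℝ HR]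
    (ι : HR →ₗ[ℝ] H) (T : HR → H →L[ℂ] H) (x : Fin n → HR)
    (hA : ∀ i : Fin n, A i = T (x i)) (hX : ∀ i : Fin n, X i = ι (x i)) :
    moment ι J T α q 0 x =
      ∑ π ∈ partitionsGeTwo n, ∑ f : {a // a ∈ arcs π} → ℤˣ,
        (α : ℂ) ^ narc ⟨π, f⟩ * (q : ℂ) ^ (rc π + 2 * rnarc ⟨π, f⟩) *
          signedCumulant ⟨π, f⟩ J A X := by
  rw [moment_eq_stateVector ι J T α q x A X hA hX, Diagram.vacuumFunctional_stateVector,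
    sum_diagrams_eq, sum_sigma]
  exact sum_congr rfl fun π _ => sum_congr rfl fun f _ => weight_code _ α q J A X

end Statistics

theorem sort_insert_of_lt {ι : Type*} [LinearOrder ι] {s : Finset ι} {a : ι}
    (h : ∀ b ∈ s, b < a) : (insert a s).sort (· ≤ ·) = s.sort (· ≤ ·) ++ [a] := by
  have hnd : (s.sort (· ≤ ·) ++ [a]).Nodup := by
    rw [List.nodup_append]
    refine ⟨sort_nodup _ _, List.nodup_singleton a, fun b hb c hc => ?_⟩
    rw [List.mem_singleton.1 hc]
    exact (h b ((mem_sort _).1 hb)).ne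
  have hs : insert a s = (s.sort (· ≤ ·) ++ [a]).toFinset := by
    ext b
    simp
  rw [hs, List.toFinset_sort _ hnd, List.pairwise_append]
  refine ⟨pairwise_sort _ _, List.pairwise_singleton _ _, fun b hb c hc => ?_⟩
  rw [List.mem_singleton.1 hc]
  exact (h b ((mem_sort _).1 hb)).le

/-! ### Noncrossing partitions and last arcs of blocks -/

section Arcs

variable {n : ℕ} {π : SetPartition n}

/-- A crossing of two blocks can be refined to a crossing of two arcs. An arc `(i, j)` of the first
block passes over `b` and has `j ≤ c < d`; an arc `(k, l)` of the second block, with `b ≤ k`, passes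
over `j`. Then `i < k < j < l`. -/
theorem isNoncrossing_of_rc_eq_zero (h : rc π = 0) : IsNoncrossing π := by
  intro B hB C hC hBC a b c d hab hbc hcd ha hc hb hd
  rw [rc, card_eq_zero] at h
  obtain rfl := π.part_eq_of_mem hB hc
  obtain rfl := π.part_eq_of_mem hC hd
  rw [← part_eq_iff_mem] at ha hb
  -- If the block of `c` has a point before `b` but does not contain `b`, the arc starting at its
  -- last point before `b` jumps over `b` and ends at or before `c`.
  have straddle : ∀ {a b c : Fin n}, a < b → b < c → π.part a = π.part c → π.part b ≠ π.part c →
      ∃ i j, (i, j) ∈ arcs π ∧ a ≤ i ∧ i < b ∧ b < j ∧ j ≤ c ∧ π.part j = π.part c := by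
    intro a b c hab hbc hac hne
    have hs : ({k | k < b ∧ π.part k = π.part c} : Finset (Fin n)).Nonempty :=
      ⟨a, by simp [hab, hac]⟩
    have hm := max'_mem _ hs
    have hle : ∀ k ∈ ({k | k < b ∧ π.part k = π.part c} : Finset (Fin n)), k ≤ max' _ hs :=
      fun k hk => le_max' _ k hk
    generalize max' _ hs = i at hm hle
    simp only [mem_filter, mem_univ, true_and] at hm hle
    obtain ⟨j, hj, hjc⟩ := exists_arc_from (hm.1.trans hbc) hm.2
    have hj' := mem_arcs_iff.1 hj
    have hjp : π.part j = π.part c := hj'.2.1.symm.trans hm.2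
    refine ⟨i, j, hj, hle a ⟨hab, hac⟩, hm.1, ?_, hjc, hjp⟩
    rcases lt_trichotomy b j with hlt | rfl | hlt
    · exact hlt
    · exact absurd hjp hne
    · exact absurd hj'.1 (not_lt.2 (hle j ⟨hlt, hjp⟩))
  have hne : π.part b ≠ π.part c := fun hh => hBC (hh.symm.trans hb)
  obtain ⟨i, j, hij, _, hib, hbj, hjc, hj⟩ := straddle hab hbc ha hne
  obtain ⟨k, l, hkl, hbk, hkj, hjl, _⟩ := straddle hbj (hjc.trans_lt hcd) hb
    fun hh => hBC (hj.symm.trans hh)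
  have : ((i, j), (k, l)) ∈ (∅ : Finset _) := by
    rw [← h, mem_filter, mem_product]
    exact ⟨⟨hij, hkl⟩, hib.trans_le hbk, hkj, hjl⟩
  exact notMem_empty _ this

theorem rc_eq_zero_iff : rc π = 0 ↔ IsNoncrossing π := by
  refine ⟨isNoncrossing_of_rc_eq_zero, fun h => ?_⟩
  rw [rc, card_eq_zero, filter_eq_empty_iff]
  rintro ⟨a, b⟩ hab ⟨h1, h2, h3⟩
  rw [mem_product] at hab
  have ha := mem_arcs_iff.1 hab.1
  have hb := mem_arcs_iff.1 hab.2
  refine h (π.part a.2) (π.part_mem.2 (mem_univ _)) (π.part b.2) (π.part_mem.2 (mem_univ _)) ?_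
    a.1 b.1 a.2 b.2 h1 h2 h3 (part_eq_iff_mem.1 ha.2.1) (mem_part_univ π _)
    (part_eq_iff_mem.1 hb.2.1) (mem_part_univ π _)
  -- If both arcs lay in one block, the start of the second would lie strictly inside the first,
  -- against consecutiveness.
  intro hp
  exact ha.2.2 b.1 (hb.2.1.trans hp.symm) ⟨h1, h2⟩

/-- The arc ending at the maximum of the block. It gives the correspondence between blocks and
terminal arcs, along which the product over arcs becomes a product over blocks. -/
theorem exists_arc_to_max (hπ : π ∈ partitionsGeTwo n) {B : Finset (Fin n)} (hB : B ∈ π.parts) :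
    ∃ a ∈ arcs π, π.part a.2 = B ∧ ∀ b ∈ arcs π, b.1 ≠ a.2 := by
  have h2 := (mem_filter.1 hπ).2 B hB
  have hne := π.nonempty_of_mem_parts hB
  have hm := B.max'_mem hne
  have hle : ∀ k ∈ B, k ≤ B.max' hne := fun k hk => B.le_max' k hk
  generalize B.max' hne = m at hm hle
  obtain rfl := π.part_eq_of_mem hB hm
  obtain ⟨k, hk, hkm⟩ := exists_mem_ne (show 1 < #(π.part m) from h2) m
  obtain ⟨i, hi, _⟩ := exists_arc_to ((hle k hk).lt_of_ne hkm) (part_eq_iff_mem.2 hk)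
  refine ⟨_, hi, rfl, fun b hb hbm => ?_⟩
  have hb' := mem_arcs_iff.1 hb
  rw [show b.1 = m from hbm] at hb'
  exact absurd hb'.1 (not_lt.2 (hle b.2 (part_eq_iff_mem.1 hb'.2.1.symm)))

theorem le_of_forall_arc_ne {m k : Fin n} (hm : ∀ b ∈ arcs π, b.1 ≠ m)
    (hk : π.part k = π.part m) : k ≤ m := by
  by_contra! hlt
  obtain ⟨j, hj, _⟩ := exists_arc_from hlt hk.symm
  exact hm _ hj rfl

end Arcs

/-! ### Evaluating the block contributions -/

section Cumulants

variable {n : ℕ} {P : TypeBPartition n} {H : Type*} [NormedAddCommGroup H] [InnerProductSpace ℂ H]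
  {J : H →L[ℂ] H} {A : ℕ → H →L[ℂ] H} {X : ℕ → H}

theorem isTerminal_code_iff {j : Fin n} :
    Diagram.IsTerminal (code P, ∅) j ↔ ∀ b ∈ arcs P.1, b.1 ≠ j := by
  simp only [Diagram.IsTerminal, notMem_empty, not_false_eq_true, true_and]
  constructor
  · rintro h b hb rfl
    exact h _ _ (code_arc P ⟨b, hb⟩)
  · intro h k s hk
    obtain ⟨b, hb, _⟩ := code_eq_some.1 hk
    exact h b.1 b.2 (Fin.ext hb)

theorem code_eq_none {j : Fin n} (h : ∀ i, (i, j) ∉ arcs P.1) : code P j = none := by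
  cases hj : code P j with
  | none => rfl
  | some t =>
    obtain ⟨⟨a, ha⟩, _, h2, _⟩ := code_eq_some.1 (show code P j = some (t.1, t.2) from hj)
    obtain rfl := Fin.ext h2
    exact absurd ha (h a.1)

/-- The hypothesis `hJ` says that the signs have no effect, either because all arcs are positive or
because the involution fixes the vectors that occur. Here `m` is the first point of its block; each
further arc adds one largest element to the sorted list and applies one more operator. -/
theorem vec_code_eq_foldl {T : Fin n → H →L[ℂ] H} {x : Fin n → H}
    (hT : ∀ i : Fin n, A i = T i) (hx : ∀ i : Fin n, X i = x i)
    (hJ : ∀ a : {a // a ∈ arcs P.1}, signMap J (P.2 a) (Diagram.vec J A X (code P) a.1.1) =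
      Diagram.vec J A X (code P) a.1.1)
    {m : Fin n} (hm : ∀ i, (i, m) ∉ arcs P.1) (j : Fin n) (hj : P.1.part j = P.1.part m) :
    Diagram.vec J A X (code P) j =
      (({i | P.1.part i = P.1.part m ∧ m < i ∧ i ≤ j} : Finset (Fin n)).sort (· ≤ ·)).foldl
        (fun v i => T i v) (x m) := by
  induction j using WellFoundedLT.induction with
  | _ j ih =>
    rcases lt_trichotomy j m with hlt | rfl | hlt
    · obtain ⟨i, hi, _⟩ := exists_arc_to hlt hj
      exact absurd hi (hm i)
    · have : univ.filter (fun i => P.1.part i = P.1.part j ∧ j < i ∧ i ≤ j) = ∅ := by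
        rw [filter_eq_empty_iff]
        rintro i _ ⟨_, h1, h2⟩
        exact absurd h1 (not_lt.2 h2)
      rw [this, sort_empty, List.foldl_nil, Diagram.vec_none (code_eq_none hm), hx]
    · obtain ⟨i, hi, hmi⟩ := exists_arc_to hlt hj.symm
      have hi' := mem_arcs_iff.1 hi
      have hins : univ.filter (fun k => P.1.part k = P.1.part m ∧ m < k ∧ k ≤ j) =
          insert j (univ.filter fun k => P.1.part k = P.1.part m ∧ m < k ∧ k ≤ i) := by
        ext k
        simp only [mem_filter, mem_univ, true_and, mem_insert]
        constructor
        · rintro ⟨h1, h2, h3⟩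
          rcases h3.eq_or_lt with rfl | h3
          · exact .inl rfl
          · refine .inr ⟨h1, h2, not_lt.1 fun h4 => hi'.2.2 k (h1.trans hj.symm) ⟨h4, h3⟩⟩
        · rintro (rfl | ⟨h1, h2, h3⟩)
          · exact ⟨hj, hlt, le_rfl⟩
          · exact ⟨h1, h2, h3.trans hi'.1.le⟩
      rw [hins, sort_insert_of_lt, List.foldl_append, ← ih i hi'.1 (hi'.2.1.trans hj),
        Diagram.vec_some (code_arc P ⟨_, hi⟩) hi'.1, hJ ⟨_, hi⟩, hT]
      · rfl
      · intro k hk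
        exact (mem_filter.1 hk).2.2.2.trans_lt hi'.1

theorem blockCumulant_eq {T : Fin n → H →L[ℂ] H} {x : Fin n → H}
    (hT : ∀ i : Fin n, A i = T i) (hx : ∀ i : Fin n, X i = x i)
    (hJ : ∀ a : {a // a ∈ arcs P.1}, signMap J (P.2 a) (Diagram.vec J A X (code P) a.1.1) =
      Diagram.vec J A X (code P) a.1.1)
    {a : Fin n × Fin n} (ha : a ∈ arcs P.1) (hm : ∀ b ∈ arcs P.1, b.1 ≠ a.2)
    (hne : (P.1.part a.2).Nonempty) :
    blockCumulant T x (P.1.part a.2) hne =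
      ⟪X a.2, Diagram.vec J A X (code P) a.1⟫_ℂ := by
  have ha' := mem_arcs_iff.1 ha
  have hmax : (P.1.part a.2).max' hne = a.2 :=
    le_antisymm (max'_le _ _ _ fun k hk => le_of_forall_arc_ne hm (part_eq_iff_mem.2 hk))
      (le_max' _ _ (mem_part_univ _ _))
  have hmin := min'_mem _ hne
  have hmin' : ∀ k ∈ P.1.part a.2, min' _ hne ≤ k := fun k hk => min'_le _ k hk
  rw [blockCumulant, hmax]
  generalize min' _ hne = m at hmin hmin'
  rw [← part_eq_iff_mem] at hmin
  -- Removing the minimum and the maximum leaves the points after `m` up to `a.1`, as `a.1` is the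
  -- predecessor of the maximum.
  have hset : ((P.1.part a.2).erase m).erase a.2 =
      ({i | P.1.part i = P.1.part m ∧ m < i ∧ i ≤ a.1} : Finset (Fin n)) := by
    ext k
    simp only [mem_erase, mem_filter, mem_univ, true_and, hmin]
    constructor
    · rintro ⟨h1, h2, h3⟩
      have h4 := part_eq_iff_mem.2 h3
      refine ⟨h4, (hmin' k h3).lt_of_ne h2.symm, not_lt.1 fun h5 => ha'.2.2 k h4 ⟨h5, ?_⟩⟩
      exact (le_of_forall_arc_ne hm h4).lt_of_ne h1
    · rintro ⟨h1, h2, h3⟩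
      exact ⟨(h3.trans_lt ha'.1).ne, h2.ne', part_eq_iff_mem.1 h1⟩
  rw [hset, ← vec_code_eq_foldl hT hx hJ _ a.1 (ha'.2.1.trans hmin.symm), hx]
  intro i hi
  have hi' := mem_arcs_iff.1 hi
  exact absurd hi'.1 (not_lt.2 (hmin' i (part_eq_iff_mem.1 (hi'.2.1.trans hmin))))

/-- Only terminal arcs contribute a factor different from `1` by definition, and sending a terminal
arc to the block of its right end is a bijection onto the blocks. -/
theorem signedCumulant_eq_partitionCumulant {T : Fin n → H →L[ℂ] H} {x : Fin n → H}
    (hP : P.1 ∈ partitionsGeTwo n)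
    (hT : ∀ i : Fin n, A i = T i) (hx : ∀ i : Fin n, X i = x i)
    (hJ : ∀ a : {a // a ∈ arcs P.1}, signMap J (P.2 a) (Diagram.vec J A X (code P) a.1.1) =
      Diagram.vec J A X (code P) a.1.1) :
    signedCumulant P J A X = partitionCumulant T x P.1 := by
  classical
  rw [signedCumulant, ← prod_filter, partitionCumulant]
  refine prod_bij (fun a _ => ⟨P.1.part a.1.2, P.1.part_mem.2 (mem_univ _)⟩) (fun _ _ => mem_univ _)
    ?_ ?_ ?_
  · intro a ha b hb h
    rw [mem_filter, isTerminal_code_iff] at ha hb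
    have hp : P.1.part a.1.2 = P.1.part b.1.2 := congrArg Subtype.val h
    exact Subtype.ext (arcs_left_unique a.2 b.2 (le_antisymm (le_of_forall_arc_ne hb.2 hp)
      (le_of_forall_arc_ne ha.2 hp.symm)))
  · rintro ⟨B, hB⟩ _
    obtain ⟨a, ha, hp, hm⟩ := exists_arc_to_max hP hB
    exact ⟨⟨a, ha⟩, by rw [mem_filter, isTerminal_code_iff]; exact ⟨mem_univ _, hm⟩,
      Subtype.ext hp⟩
  · intro a ha
    rw [mem_filter, isTerminal_code_iff] at ha
    rw [hJ]
    exact (blockCumulant_eq hT hx hJ a.2 ha.2 _).symm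

/-- In a pair partition no two arcs are consecutive: every arc is terminal, and its starting point
carries the original vector, without any operator applied. -/
theorem signedCumulant_of_pairs (hP : ∀ B ∈ P.1.parts, #B = 2) :
    signedCumulant P J A X =
      (∏ a with P.2 a = 1, ⟪X a.1.2, X a.1.1⟫_ℂ) *
        ∏ a with P.2 a = -1, ⟪X a.1.2, J (X a.1.1)⟫_ℂ := by
  classical
  have hthree : ∀ {i j k : Fin n}, (i, j) ∈ arcs P.1 → (j, k) ∉ arcs P.1 := by
    intro i j k h h'
    rw [mem_arcs_iff] at h h'
    have hc := hP _ (P.1.part_mem.2 (mem_univ k))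
    have : 2 < #(P.1.part k) := two_lt_card.2 ⟨i, part_eq_iff_mem.1 (h.2.1.trans h'.2.1), j,
      part_eq_iff_mem.1 h'.2.1, k, mem_part_univ _ _, h.1.ne, (h.1.trans h'.1).ne, h'.1.ne⟩
    omega
  rw [signedCumulant, prod_filter, prod_filter, ← prod_mul_distrib]
  refine prod_congr rfl fun a _ => ?_
  have h1 : Diagram.IsTerminal (code P, ∅) a.1.2 := by
    rw [isTerminal_code_iff]
    intro b hb hba
    exact hthree a.2 (k := b.2) (hba ▸ hb)
  have h2 : code P a.1.1 = none := code_eq_none fun i hi => hthree hi a.2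
  rw [if_pos h1, Diagram.vec_none h2]
  rcases Int.units_eq_one_or (P.2 a) with h | h <;> simp [h, signMap]

/-- In a block with at least three points the last arc starts at a point where another arc ends. The
vector there is the image of an operator `A i = 0`, so the factor of the last arc vanishes. -/
theorem signedCumulant_eq_zero (hA : ∀ i, A i = 0) (hP : P.1 ∈ partitionsGeTwo n)
    (h : ¬ ∀ B ∈ P.1.parts, #B = 2) : signedCumulant P J A X = 0 := by
  classical
  push Not at h
  obtain ⟨B, hB, hcard⟩ := h
  have h2 := (mem_filter.1 hP).2 B hB
  obtain ⟨a, ha, rfl, hm⟩ := exists_arc_to_max hP hB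
  have ha' := mem_arcs_iff.1 ha
  obtain ⟨k, hk, hka⟩ : ∃ k ∈ P.1.part a.2, k ∉ ({a.1, a.2} : Finset (Fin n)) := by
    refine exists_mem_notMem_of_card_lt_card (lt_of_le_of_lt card_le_two ?_)
    omega
  rw [← part_eq_iff_mem] at hk
  simp only [mem_insert, mem_singleton, not_or] at hka
  have hk2 : k < a.2 := (le_of_forall_arc_ne hm hk).lt_of_ne hka.2
  have hk1 : k < a.1 := (not_lt.1 fun hlt => ha'.2.2 k hk ⟨hlt, hk2⟩).lt_of_ne hka.1
  obtain ⟨i, hi, _⟩ := exists_arc_to hk1 (hk.trans ha'.2.1.symm)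
  rw [signedCumulant]
  refine prod_eq_zero (mem_univ ⟨a, ha⟩) ?_
  rw [if_pos (isTerminal_code_iff.2 hm),
    Diagram.vec_some (code_arc P ⟨_, hi⟩) (mem_arcs_iff.1 hi).1, hA]
  simp

/-- Fixed vectors stay fixed under operators commuting with the involution, so by induction along
the block the signs act trivially. -/
theorem apply_vec_code (hX : ∀ i, J (X i) = X i) (hA : ∀ i, Commute J (A i)) (j : ℕ) :
    J (Diagram.vec J A X (code P) j) = Diagram.vec J A X (code P) j := by
  induction j using Nat.strong_induction_on with
  | _ j ih =>
    cases h : code P j with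
    | none => rw [Diagram.vec_none h, hX]
    | some t =>
      have hlt : t.1 < j := by
        obtain ⟨a, h1, rfl, _⟩ := code_eq_some.1 (show code P j = some (t.1, t.2) from h)
        rw [← h1]
        exact (mem_arcs_iff.1 a.2).1
      have hs : signMap J t.2 (Diagram.vec J A X (code P) t.1) =
          Diagram.vec J A X (code P) t.1 := by
        rw [signMap]
        split_ifs
        · rfl
        · exact ih _ hlt
      rw [Diagram.vec_some (i := t.1) (s := t.2) h hlt, hs, ← mul_apply_eq_comp,
        (hA j).eq, mul_apply_eq_comp, ih _ hlt]

end Cumulants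

/-! ### The sum over colourings at `q = 0` and the three cases -/

/-- With no crossings the summand is a product over arcs, so the sum over colourings is the product
of `1 + α * 0 ^ (2 * nestingNumber)`. Since `0 ^ 0 = 1`, this factor is `1 + α` exactly for the
outer arcs and `1` for the others. With a crossing, the power of `0` is positive for every
colouring. -/
theorem sum_colourings (n : ℕ) (π : SetPartition n) (α : ℂ) :
    ∑ f : {a // a ∈ arcs π} → ℤˣ, α ^ narc ⟨π, f⟩ * (0 : ℂ) ^ (rc π + 2 * rnarc ⟨π, f⟩) =
      if rc π = 0 then (1 + α) ^ outArc π else 0 := by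
  classical
  split_ifs with h
  · have hf : ∀ f : {a // a ∈ arcs π} → ℤˣ,
        α ^ narc ⟨π, f⟩ * (0 : ℂ) ^ (rc π + 2 * rnarc ⟨π, f⟩) =
          ∏ a, if f a = 1 then 1 else α * 0 ^ (2 * nestingNumber π a.1) := by
      intro f
      rw [h, zero_add, narc_eq_sum, rnarc_eq_sum, mul_sum, ← prod_pow_eq_pow_sum,
        ← prod_pow_eq_pow_sum, ← prod_mul_distrib]
      refine prod_congr rfl fun a _ => ?_
      dsimp only
      split_ifs <;> simp
    rw [sum_congr rfl fun f _ => hf f, ← Fintype.piFinset_univ,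
      ← prod_univ_sum (fun _ => univ)
        (fun (a : {a // a ∈ arcs π}) (s : ℤˣ) => if s = 1 then (1 : ℂ) else
          α * 0 ^ (2 * nestingNumber π a.1)),
      prod_coe_sort (arcs π) (fun a => ∑ s : ℤˣ, if s = 1 then (1 : ℂ) else
          α * 0 ^ (2 * nestingNumber π a)), outArc, ← prod_const, prod_filter]
    refine prod_congr rfl fun a _ => ?_
    have h2 : (-1 : ℤˣ) ≠ 1 := by decide
    rw [sum_signs, if_pos rfl, if_neg h2]
    split_ifs with ho
    · rw [nestingNumber, filter_eq_empty_iff.2 fun b hb => ho b hb]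
      simp
    · have : nestingNumber π a ≠ 0 := by
        rw [nestingNumber, Ne, card_eq_zero, filter_eq_empty_iff]
        exact fun hh => ho fun b hb => hh hb
      simp [this]
  · exact sum_eq_zero fun f _ => by rw [zero_pow (by omega), mul_zero]

end TypeB

end

theorem mainTheorem10
    {HR H : Type*} [NormedAddCommGroup HR] [InnerProductSpace ℝ HR] [CompleteSpace HR]
    [NormedAddCommGroup H] [InnerProductSpace ℂ H] [CompleteSpace H]
    (ι : HR →ₗ[ℝ] H) (hι : TypeB.IsComplexification ι)
    (J : H →L[ℂ] H) (hJ : IsSelfAdjoint J) (hJJ : ∀ z, J (J z) = z)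
    (T : HR → H →L[ℂ] H) (hT : ∀ u, IsSelfAdjoint (T u))
    (α q : ℝ) (hα : α ∈ Set.Ioo (-1 : ℝ) 1) (hq : q ∈ Set.Ioo (-1 : ℝ) 1)
    {n : ℕ} (x : Fin n → HR) :
    -- the case `α = λ = 0`
    (TypeB.moment ι J T 0 q 0 x =
      ∑ π ∈ TypeB.partitionsGeTwo n,
        (q : ℂ) ^ TypeB.rc π *
          TypeB.partitionCumulant (fun i => T (x i)) (fun i => ι (x i)) π) ∧
    -- the case `T = 0`, `λ = 0`
    (TypeB.moment ι J (fun _ => 0) α q 0 x =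
      ∑ p ∈ TypeB.typeBPairPartitions n,
        (α : ℂ) ^ TypeB.narc p * (q : ℂ) ^ (TypeB.rc p.1 + 2 * TypeB.rnarc p) *
          ((∏ a with p.2 a = 1, ⟪ι (x a.1.2), ι (x a.1.1)⟫_ℂ) *
            ∏ a with p.2 a = -1, ⟪ι (x a.1.2), J (ι (x a.1.1))⟫_ℂ)) ∧
    -- the case `q = λ = 0`, where the involution fixes the vectors and commutes with the operators
    ((∀ i, J (ι (x i)) = ι (x i)) → (∀ i, Commute J (T (x i))) →
      TypeB.moment ι J T α 0 0 x =
        ∑ π ∈ TypeB.noncrossingGeTwo n,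
          (1 + (α : ℂ)) ^ TypeB.outArc π *
            TypeB.partitionCumulant (fun i => T (x i)) (fun i => ι (x i)) π) := by
  classical
  -- Extension by zero keeps the assumptions of the third case valid at all natural numbers: the
  -- involution fixes `0`, and the zero operator commutes with it.
  obtain ⟨X, hX, hX0⟩ : ∃ X : ℕ → H, (∀ i : Fin n, X i = ι (x i)) ∧ ∀ i, n ≤ i → X i = 0 :=
    ⟨fun i => if h : i < n then ι (x ⟨i, h⟩) else 0, fun i => dif_pos i.2,
      fun i hi => dif_neg (not_lt.2 hi)⟩
  obtain ⟨A, hA, hA0⟩ : ∃ A : ℕ → H →L[ℂ] H,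
      (∀ i : Fin n, A i = T (x i)) ∧ ∀ i, n ≤ i → A i = 0 :=
    ⟨fun i => if h : i < n then T (x ⟨i, h⟩) else 0, fun i => dif_pos i.2,
      fun i hi => dif_neg (not_lt.2 hi)⟩
  refine ⟨?_, ?_, fun hJx hJT => ?_⟩
  · rw [TypeB.moment_eq_sum 0 q J A X ι T x hA hX]
    refine Finset.sum_congr rfl fun π hπ => ?_
    have h1 : TypeB.narc (⟨π, fun _ => 1⟩ : TypeB.TypeBPartition n) = 0 := by
      simp [TypeB.narc_eq_sum]
    have h2 : TypeB.rnarc (⟨π, fun _ => 1⟩ : TypeB.TypeBPartition n) = 0 := by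
      simp [TypeB.rnarc_eq_sum]
    -- For `α = 0` the factor `0 ^ narc` removes every colouring with a negative arc.
    rw [Finset.sum_eq_single (fun _ => 1)]
    · rw [h1, h2, TypeB.signedCumulant_eq_partitionCumulant hπ hA hX fun a => by
        simp [TypeB.signMap]]
      simp
    · intro f _ hf
      have : TypeB.narc (⟨π, f⟩ : TypeB.TypeBPartition n) ≠ 0 := by
        obtain ⟨a, ha⟩ := Function.ne_iff.1 hf
        rw [TypeB.narc_eq_sum]
        intro h
        have := (Finset.sum_eq_zero_iff.1 h) a (Finset.mem_univ a)
        rw [if_neg ha] at this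
        exact one_ne_zero this
      rw [Complex.ofReal_zero, zero_pow this, zero_mul, zero_mul]
    · exact fun h => absurd (Finset.mem_univ _) h
  · rw [TypeB.moment_eq_sum α q J (fun _ => 0) X ι (fun _ => 0) x (fun _ => rfl) hX,
      Finset.sum_sigma' _ _ fun (π : TypeB.SetPartition n) (f : {a // a ∈ TypeB.arcs π} → ℤˣ) =>
        (α : ℂ) ^ TypeB.narc ⟨π, f⟩ * (q : ℂ) ^ (TypeB.rc π + 2 * TypeB.rnarc ⟨π, f⟩) *
          TypeB.signedCumulant ⟨π, f⟩ J (fun _ => 0) X]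
    symm
    -- Pair partitions are among the partitions without singletons; the others contain a block of at
    -- least three points and contribute zero.
    refine Finset.sum_subset_zero_on_sdiff ?_ ?_ ?_
    · intro p hp
      refine Finset.mem_sigma.2 ⟨Finset.mem_filter.2 ⟨Finset.mem_univ _, fun B hB => ?_⟩,
        Finset.mem_univ _⟩
      exact ((Finset.mem_filter.1 hp).2 B hB).ge
    · intro p hp
      rw [Finset.mem_sdiff] at hp
      have h1 : ¬ ∀ B ∈ p.1.parts, B.card = 2 := fun h =>
        hp.2 (Finset.mem_filter.2 ⟨Finset.mem_univ _, h⟩)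
      rw [TypeB.signedCumulant_eq_zero (fun _ => rfl) (Finset.mem_sigma.1 hp.1).1 h1, mul_zero]
    · intro p hp
      rw [TypeB.signedCumulant_of_pairs (Finset.mem_filter.1 hp).2]
      simp only [hX]
  · have hJX : ∀ i, J (X i) = X i := fun i => by
      rcases lt_or_ge i n with h | h
      · rw [hX ⟨i, h⟩, hJx]
      · rw [hX0 i h, map_zero]
    have hJA : ∀ i, Commute J (A i) := fun i => by
      rcases lt_or_ge i n with h | h
      · rw [hA ⟨i, h⟩]
        exact hJT _
      · rw [hA0 i h]
        exact Commute.zero_right J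
    rw [TypeB.moment_eq_sum α 0 J A X ι T x hA hX, TypeB.noncrossingGeTwo, Finset.sum_filter]
    refine Finset.sum_congr rfl fun π hπ => ?_
    have hs : ∀ f, TypeB.signedCumulant ⟨π, f⟩ J A X =
        TypeB.partitionCumulant (fun i => T (x i)) (fun i => ι (x i)) π := fun f => by
      refine TypeB.signedCumulant_eq_partitionCumulant (P := ⟨π, f⟩) hπ hA hX fun a => ?_
      rw [TypeB.signMap]
      split_ifs
      · rfl
      · exact TypeB.apply_vec_code hJX hJA _
    simp only [hs]
    -- The block factor is the same for all colourings, so the sum over colourings can be evaluated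
    -- separately.
    rw [← Finset.sum_mul, Complex.ofReal_zero, TypeB.sum_colourings, ite_mul, zero_mul]
    exact if_congr TypeB.rc_eq_zero_iff rfl rfl
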